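/- Let $n \ge 2$ and let $C_n$ be a primitive multiple curve of multiplicity $n$ over $\mathbb{C}$: a separated Cohen–Macaulay scheme of finite type over $\mathbb{C}$ whose reduced subscheme $C = (C_n)_{\mathrm{red}}$ is a smooth irreducible curve, and such that every closed point $P$ has an open neighbourhood $U$ which embeds in a smooth surface $S$ in such a way that the ideal of $C$ in $\mathcal{O}_{S,P}$ is generated by an element $z$ and the ideal of $C_n$ in $\mathcal{O}_{S,P}$ is generated by $z^n$. Let $\mathcal{I}_C \subset \mathcal{O}_{C_n}$ be the ideal sheaf of $C$, let $L = \mathcal{I}_C/\mathcal{I}_C^2$ be the associated line bundle on $C$, and let $C_{n-1} \subset C_n$ be the closed subscheme defined by $\mathcal{I}_C^{\,n-1}$ (locally of equation $z^{n-1}$ in $S$). Then the canonical morphism of sheaves of Kähler differentials over $\mathbb{C}$ $$\rho_n : \Omega_{C_n}|_{C_{n-1}} \longrightarrow \Omega_{C_{n-1}}$$ is surjective, and its kernel is isomorphic, as an $\mathcal{O}_{C_{n-1}}$-module, to $L^{n-1} = L^{\otimes (n-1)}$ (extended from $C$ to $C_{n-1}$). Consequently there is an exact sequence of sheaves on $C_{n-1}$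 $$0 \longrightarrow L^{n-1} \longrightarrow \Omega_{C_n}|_{C_{n-1}} \xrightarrow{\ \rho_n\ } \Omega_{C_{n-1}} \longrightarrow 0 .$$ -/

import Mathlib

open CategoryTheory Limits AlgebraicGeometry

noncomputable section

namespace MultipleCurve

universe u

/-! ### Modules on a scheme: structure sheaf, sheafification, tensor product -/

/-- The structure sheaf `𝒪_X` as a sheaf of `𝒪_X`-modules. -/
def structureModule (X : Scheme.{u}) : X.Modules :=
  SheafOfModules.unit X.ringCatSheaf

/-- The sheaf of modules associated with a presheaf of `𝒪_X`-modules. -/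
def sheafify (X : Scheme.{u})
    (P : PresheafOfModules.{u} (X.presheaf ⋙ forget₂ CommRingCat RingCat)) : X.Modules :=
  (PresheafOfModules.sheafification (𝟙 X.ringCatSheaf.obj)).obj P

/-- An `𝒪_X`-module, seen as a presheaf of modules over the presheaf of commutative rings `𝒪_X`. -/
def toPre {X : Scheme.{u}} (M : X.Modules) :
    PresheafOfModules.{u} (X.presheaf ⋙ forget₂ CommRingCat RingCat) :=
  M.val

/-- The canonical map from a presheaf of modules to the associated sheaf. -/
def toSheafify (X : Scheme.{u})
    (P : PresheafOfModules.{u} (X.presheaf ⋙ forget₂ CommRingCat RingCat)) :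
    P ⟶ toPre (sheafify X P) :=
  (PresheafOfModules.sheafificationAdjunction (𝟙 X.ringCatSheaf.obj)).unit.app P

/-- The universal property of the associated sheaf. -/
def sheafifyDesc {X : Scheme.{u}}
    {P : PresheafOfModules.{u} (X.presheaf ⋙ forget₂ CommRingCat RingCat)} {M : X.Modules}
    (f : P ⟶ toPre M) : sheafify X P ⟶ M :=
  ((PresheafOfModules.sheafificationAdjunction (𝟙 X.ringCatSheaf.obj)).homEquiv P M).symm f

open MonoidalCategory in
/-- The tensor product `M ⊗ N` of `𝒪_X`-modules: the sheaf associated with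
`U ↦ M(U) ⊗_{𝒪_X(U)} N(U)`. -/
def tensor {X : Scheme.{u}} (M N : X.Modules) : X.Modules :=
  sheafify X (toPre M ⊗ toPre N)

/-- The tensor power `M^{⊗ k}`. -/
def tensorPow {X : Scheme.{u}} (M : X.Modules) : ℕ → X.Modules
  | 0 => structureModule X
  | k + 1 => tensor (tensorPow M k) M

/-! ### Kähler differentials of a scheme over an affine base -/

/-- The map from the constant presheaf `R` to `𝒪_X` given by a morphism `X ⟶ Spec R`. -/
def constToPresheaf {R : CommRingCat.{u}} {X : Scheme.{u}} (a : X ⟶ Spec R) :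
    (Functor.const (TopologicalSpace.Opens X)ᵒᵖ).obj R ⟶ X.presheaf where
  app U := (Scheme.ΓSpecIso R).inv ≫ a.appTop ≫ X.presheaf.map (homOfLE le_top).op
  naturality U V f := by
    simp only [Functor.const_obj_obj, Functor.const_obj_map, Category.id_comp, Category.assoc,
      ← Functor.map_comp]
    rfl

/-- The presheaf `U ↦ Ω_{𝒪_X(U)/R}`. -/
def preOmega {R : CommRingCat.{u}} {X : Scheme.{u}} (a : X ⟶ Spec R) :
    PresheafOfModules.{u} (X.presheaf ⋙ forget₂ CommRingCat RingCat) :=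
  PresheafOfModules.DifferentialsConstruction.relativeDifferentials' (constToPresheaf a)

/-- The sheaf of Kähler differentials `Ω_{X/R}`: the sheaf associated with
`U ↦ Ω_{𝒪_X(U)/R}`. -/
def omega {R : CommRingCat.{u}} {X : Scheme.{u}} (a : X ⟶ Spec R) : X.Modules :=
  sheafify X (preOmega a)

/-- The universal derivation `d : 𝒪_X → Ω_{X/R}`. -/
def omegaD {R : CommRingCat.{u}} {X : Scheme.{u}} (a : X ⟶ Spec R) :
    (toPre (omega a)).Derivation' (constToPresheaf a) :=
  (PresheafOfModules.DifferentialsConstruction.derivation' (constToPresheaf a)).postcomp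
    (toSheafify X (preOmega a))

/-- For an `R`-morphism `i : Z ⟶ X`, the derivation `𝒪_X → i_* Ω_{Z/R}`, `f ↦ d(i^♯ f)`. -/
def pushforwardD {R : CommRingCat.{u}} {X Z : Scheme.{u}} (i : Z ⟶ X) (a : X ⟶ Spec R) :
    (toPre ((Scheme.Modules.pushforward i).obj (omega (i ≫ a)))).Derivation'
      (constToPresheaf a) where
  d {U} := ((omegaD (i ≫ a)).d (X := .op (i ⁻¹ᵁ U.unop))).comp (i.app U.unop).hom.toAddMonoidHom
  d_mul {U} x y := by
    have h := (omegaD (i ≫ a)).d_mul (X := .op (i ⁻¹ᵁ U.unop)) (i.app U.unop x) (i.app U.unop y)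
    change (omegaD (i ≫ a)).d (X := .op (i ⁻¹ᵁ U.unop)) (i.app U.unop (x * y)) = _
    rw [map_mul, h]
    rfl
  d_map {U V} f x := by
    have h := (omegaD (i ≫ a)).d_map ((TopologicalSpace.Opens.map i.base).op.map f)
      (i.app U.unop x)
    have e : i.app V.unop (X.presheaf.map f x) =
        Z.presheaf.map ((TopologicalSpace.Opens.map i.base).op.map f) (i.app U.unop x) :=
      ConcreteCategory.congr_hom (i.naturality f) x
    exact (congrArg _ e).trans h
  d_app {U} r := by
    have h := (omegaD (i ≫ a)).d_app (X := .op (i ⁻¹ᵁ U.unop)) r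
    have e : i.app U.unop ((constToPresheaf a).app U r) =
        (constToPresheaf (i ≫ a)).app (.op (i ⁻¹ᵁ U.unop)) r := by
      have h1 := ConcreteCategory.congr_hom (i.naturality (homOfLE le_top : U.unop ⟶ ⊤).op)
        (a.appTop ((Scheme.ΓSpecIso R).inv r))
      refine h1.trans ?_
      simp [constToPresheaf]
      rfl
    exact (congrArg _ e).trans h

/-- The map from the presheaf `U ↦ Ω_{𝒪_X(U)/R}` to `i_* Ω_{Z/R}` that sends `df` to
`d(i^♯ f)`. -/
def preOmegaMap {R : CommRingCat.{u}} {X Z : Scheme.{u}} (i : Z ⟶ X) (a : X ⟶ Spec R) :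
    preOmega a ⟶ toPre ((Scheme.Modules.pushforward i).obj (omega (i ≫ a))) :=
  (PresheafOfModules.DifferentialsConstruction.isUniversal' (constToPresheaf a)).desc
    (pushforwardD i a)

/-- The morphism `Ω_{X/R} ⟶ i_* Ω_{Z/R}` that sends `df` to `d(i^♯ f)`. -/
def omegaMap {R : CommRingCat.{u}} {X Z : Scheme.{u}} (i : Z ⟶ X) (a : X ⟶ Spec R) :
    omega a ⟶ (Scheme.Modules.pushforward i).obj (omega (i ≫ a)) :=
  sheafifyDesc (preOmegaMap i a)

/-- The canonical morphism `i^* Ω_{X/R} ⟶ Ω_{Z/R}` of an `R`-morphism `i : Z ⟶ X`, adjoint to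
`Ω_{X/R} ⟶ i_* Ω_{Z/R}`. For a closed immersion `i`,
the source is the restriction of `Ω_{X/R}` to `Z`. -/
def omegaPullbackMap {R : CommRingCat.{u}} {X Z : Scheme.{u}} (i : Z ⟶ X) (a : X ⟶ Spec R) :
    (Scheme.Modules.pullback i).obj (omega a) ⟶ omega (i ≫ a) :=
  ((Scheme.Modules.pullbackPushforwardAdjunction i).homEquiv _ _).symm
    (omegaMap i a)

/-! ### Ideal sheaves and conormal sheaves -/

/-- The canonical morphism `𝒪_X ⟶ i_* 𝒪_Z`. -/
def structureMap {X Z : Scheme.{u}} (i : Z ⟶ X) :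
    structureModule X ⟶ (Scheme.Modules.pushforward i).obj (structureModule Z) :=
  SheafOfModules.unitToPushforwardObjUnit i.toRingCatSheafHom

/-- An ideal sheaf `I`, as an `𝒪_X`-module: the kernel of `𝒪_X ⟶ 𝒪_{V(I)}`. -/
def idealModule {X : Scheme.{u}} (I : X.IdealSheafData) : X.Modules :=
  kernel (structureMap I.subschemeι)

lemma idealModule_condition {X : Scheme.{u}} {I J : X.IdealSheafData} (h : I ≤ J) :
    kernel.ι (structureMap I.subschemeι) ≫ structureMap J.subschemeι = 0 := by
  apply Scheme.Modules.hom_ext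
  intro U
  ext x
  have h0 : (kernel.ι (structureMap I.subschemeι) ≫ structureMap I.subschemeι).app U x = 0 := by
    rw [kernel.condition]; rfl
  let y : Γ(X, U) := (kernel.ι (structureMap I.subschemeι)).app U x
  have h1 : I.subschemeι.app U y = 0 := h0
  change J.subschemeι.app U y = 0
  have h2 : J.subschemeι = Scheme.IdealSheafData.inclusion h ≫ I.subschemeι := by simp
  rw [Scheme.Hom.congr_app h2 U]
  simp [h1]

/-- The inclusion of ideal sheaves `I ⊆ J`, as a morphism of `𝒪_X`-modules. -/
def idealInclusion {X : Scheme.{u}} {I J : X.IdealSheafData} (h : I ≤ J) :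
    idealModule I ⟶ idealModule J :=
  kernel.lift _ (kernel.ι _) (idealModule_condition h)

lemma pow_le_self {X : Scheme.{u}} (I : X.IdealSheafData) {k : ℕ} (hk : k ≠ 0) : I ^ k ≤ I :=
  fun _ => Ideal.pow_le_self hk

/-- The conormal sheaf of the closed subscheme `V(I)`: the `𝒪_X`-module `I / I²`, which is
annihilated by `I`, seen as a module on `V(I)`. -/
def conormal {X : Scheme.{u}} (I : X.IdealSheafData) : I.subscheme.Modules :=
  (Scheme.Modules.pullback I.subschemeι).obj
    (cokernel (idealInclusion (pow_le_self I two_ne_zero)))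

/-! ### Primitive multiple curves -/

/-- A (Noetherian) local ring is Cohen-Macaulay if some regular sequence has length equal to the
Krull dimension. -/
def IsCohenMacaulayLocalRing (A : Type u) [CommRing A] [IsLocalRing A] : Prop :=
  ∃ rs : List A, RingTheory.Sequence.IsRegular A rs ∧ (rs.length : WithBot ℕ∞) = ringKrullDim A

/-- The reduced subscheme `C = Y_red`. -/
abbrev reducedCurve (Y : Scheme.{u}) : Scheme.{u} := Y.nilradical.subscheme

/-- The closed subscheme `C_i ⊆ Y` of the canonical filtration, defined by `I_C ^ i`: where `Y` is
embedded in a smooth surface and `z` is a local equation of `C` there, `C_i` has equation `z ^ i`. -/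
abbrev filtration (Y : Scheme.{u}) (i : ℕ) : Scheme.{u} := (Y.nilradical ^ i).subscheme

/-- The closed immersion `C_i ⟶ Y`. -/
abbrev filtrationι (Y : Scheme.{u}) (i : ℕ) : filtration Y i ⟶ Y :=
  (Y.nilradical ^ i).subschemeι

/-- The closed immersion `C ⟶ C_i`, for `i ≠ 0`. -/
abbrev reducedToFiltration (Y : Scheme.{u}) {i : ℕ} (hi : i ≠ 0) :
    reducedCurve Y ⟶ filtration Y i :=
  Scheme.IdealSheafData.inclusion (pow_le_self Y.nilradical hi)

/-- The line bundle `L = I_C / I_C²` on `C` associated with `Y`. -/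
abbrev associatedLineBundle (Y : Scheme.{u}) : (reducedCurve Y).Modules :=
  conormal Y.nilradical

/-- `Y`, with structure morphism `a : Y ⟶ Spec ℂ`, is a primitive multiple curve of
multiplicity `n`. -/
structure IsPrimitiveMultipleCurve {Y : Scheme.{0}} (a : Y ⟶ Spec (.of ℂ)) (n : ℕ) : Prop where
  isSeparated : IsSeparated a
  quasiCompact : QuasiCompact a
  locallyOfFiniteType : LocallyOfFiniteType a
  /-- `Y` is Cohen-Macaulay. -/
  cohenMacaulay : ∀ y : Y, IsCohenMacaulayLocalRing (Y.presheaf.stalk y)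
  /-- `C = Y_red` is irreducible. -/
  irreducible : IrreducibleSpace (reducedCurve Y)
  /-- `C = Y_red` is a smooth curve. -/
  smooth : SmoothOfRelativeDimension 1 (Y.nilradical.subschemeι ≫ a)
  /-- Every closed point `y` has an open neighbourhood `U` with an embedding `j : U ⟶ S` into a
  smooth surface such that the ideal of `C` in `𝒪_{S,y}` is generated by some `z` and the
  ideal of `Y` in `𝒪_{S,y}` is generated by `z ^ n`. -/
  locallyEmbedded : ∀ y : Y, IsClosed {y} →
    ∃ (U : Y.Opens) (hy : y ∈ U) (S : Scheme.{0}) (b : S ⟶ Spec (.of ℂ)) (j : U.toScheme ⟶ S),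
      SmoothOfRelativeDimension 2 b ∧ IsImmersion j ∧ j ≫ b = U.ι ≫ a ∧
      ∃ z : S.presheaf.stalk (j ⟨y, hy⟩),
        (nilradical (U.toScheme.presheaf.stalk ⟨y, hy⟩)).comap (j.stalkMap ⟨y, hy⟩).hom =
          Ideal.span {z} ∧
        RingHom.ker (j.stalkMap ⟨y, hy⟩).hom = Ideal.span {z ^ n}

/-- For `Y = C_n` with structure morphism `a`, the canonical morphism
`ρ : Ω_{C_n}|_{C_i} ⟶ Ω_{C_i}`. -/
abbrev rho {Y : Scheme.{0}} (a : Y ⟶ Spec (.of ℂ)) (i : ℕ) :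
    (Scheme.Modules.pullback (filtrationι Y i)).obj (omega a) ⟶ omega (filtrationι Y i ≫ a) :=
  omegaPullbackMap (filtrationι Y i) a

/-- The power `L ^ k` of the associated line bundle, as a sheaf on `C_i`, by extension from `C`. -/
abbrev linePow (Y : Scheme.{u}) {i : ℕ} (hi : i ≠ 0) (k : ℕ) : (filtration Y i).Modules :=
  (Scheme.Modules.pushforward (reducedToFiltration Y hi)).obj
    (tensorPow (associatedLineBundle Y) k)

end MultipleCurve

end

/-! Put m = n - 1 and let I be the nilradical, so that C_{n-1} = V(I^m). The conormal sequence of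
V(I^m) in C_n is right exact; the point is that its left-hand term is L^m and that its left-hand map
d is injective. Locally C_n has ring A = O_S/(z^{m+1}) and C has ring R = A/z. The ideal I^m is
generated by z^m and killed by z, hence is free of rank one over R, like L^m. The map d sends z^m to
m z^{m-1} dz, and it is injective because m is invertible and dz is part of a basis of the
differentials of S along C.

At each closed point this computation is packaged as `TransversalData`. Smoothness of C yields a
derivation D : O_S → R with D z a unit (`exists_derivation_isUnit`). Formal smoothness of O_S
integrates D to a homomorphism O_S → R[X]/(X^{m+1}), which factors through A because z goes to a
multiple of X (`nonempty_transversalData`). Composing with d/dX gives a derivation δ : A →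
R[X]/(X^m). For a in the kernel of A → R it satisfies δ(a^m) = m c(a)^m X^{m-1}, where c is the
coefficient of X, that is, the map induced by D (`truncatedDerivative_pow`).

These data are chosen independently at the closed points, so they are assembled in a Godement sheaf,
the product of the modules R[X]/(X^m), where no compatibility is required. The maps δ send the
pullback of I^m there through Ω; the maps c send L^m there through r ↦ m r X^{m-1}. By the formula,
the local generators z^m and z ⊗ ... ⊗ z have the same image, and the annihilator of that image
kills both generators. Hence both morphisms are monomorphisms with the same local sections in their
images (`mono_and_nonempty_iso_of_generatesAt`), which gives the isomorphism with L^m and the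
injectivity of d at once, without gluing. Closed points suffice because the schemes involved are
Jacobson. The rest of the sequence is `conormal_exact` and `epi_omegaPullbackMap`. -/

open CategoryTheory Limits AlgebraicGeometry TopologicalSpace Opposite

noncomputable section

namespace MultipleCurve

universe u

/-! ### Godement sheaves: products of modules over stalks. -/

section

variable {X : Scheme.{u}} {Λ : Type u} (x : Λ → X) (N : Λ → Type u)
  [∀ l, AddCommGroup (N l)]

/-- The presheaf of abelian groups `U ↦ ∏ N l`, the product over those `l` with `x l ∈ U`. -/
@[simps]
def godementPresheaf : TopCat.Presheaf Ab.{u} X where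
  obj U := AddCommGrpCat.of (∀ l : {l // x l ∈ U.unop}, N l.1)
  map {U V} f := AddCommGrpCat.ofHom
    { toFun := fun s l => s ⟨l.1, f.unop.le l.2⟩
      map_zero' := rfl
      map_add' := fun _ _ => rfl }

/-- Gluing is pointwise: the value at `l` is read off any member of the cover that contains `x l`,
and compatibility makes the choice irrelevant. -/
lemma godementPresheaf_isSheaf : (godementPresheaf x N).IsSheaf := by
  rw [TopCat.Presheaf.isSheaf_iff_isSheaf_comp (forget Ab.{u}),
    TopCat.Presheaf.isSheaf_iff_isSheafUniqueGluing_types]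
  intro ι U sf hsf
  have key : ∀ (i j : ι) (l : Λ) (hi : x l ∈ U i) (hj : x l ∈ U j),
      (show ∀ l : {l // x l ∈ U i}, N l.1 from sf i) ⟨l, hi⟩ =
        (show ∀ l : {l // x l ∈ U j}, N l.1 from sf j) ⟨l, hj⟩ := by
    intro i j l hi hj
    exact congr_fun (hsf i j) ⟨l, show x l ∈ U i ⊓ U j from ⟨hi, hj⟩⟩
  refine ⟨fun l => (show ∀ l' : {l' // x l' ∈ U (Opens.mem_iSup.1 l.2).choose}, N l'.1 from
    sf (Opens.mem_iSup.1 l.2).choose) ⟨l.1, (Opens.mem_iSup.1 l.2).choose_spec⟩, ?_, ?_⟩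
  · intro i
    funext l
    exact key _ _ l _ _
  · intro s hs
    funext l
    exact congr_fun (hs (Opens.mem_iSup.1 l.2).choose) ⟨l.1, (Opens.mem_iSup.1 l.2).choose_spec⟩

variable [∀ l, Module (X.presheaf.stalk (x l)) (N l)]

instance (U : X.Opens) : SMul Γ(X, U) (∀ l : {l // x l ∈ U}, N l.1) where
  smul f s := fun l => X.presheaf.germ U (x l.1) l.2 f • s l

instance godementModule (U : X.Opens) : Module Γ(X, U) (∀ l : {l // x l ∈ U}, N l.1) where
  one_smul s := by
    funext l
    change X.presheaf.germ U (x l.1) l.2 1 • s l = _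
    rw [map_one, one_smul]
  mul_smul f g s := by
    funext l
    change X.presheaf.germ U (x l.1) l.2 (f * g) • s l = _
    rw [map_mul, mul_smul]; rfl
  smul_zero f := by
    funext l
    exact smul_zero (X.presheaf.germ U (x l.1) l.2 f)
  smul_add f s t := by
    funext l
    exact smul_add (X.presheaf.germ U (x l.1) l.2 f) _ _
  add_smul f g s := by
    funext l
    change X.presheaf.germ U (x l.1) l.2 (f + g) • s l = _
    rw [map_add, add_smul]; rfl
  zero_smul s := by
    funext l
    change X.presheaf.germ U (x l.1) l.2 0 • s l = _
    rw [map_zero, zero_smul]; rfl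

instance godementPresheafModule (U : X.Opensᵒᵖ) :
    Module ((X.presheaf ⋙ forget₂ CommRingCat RingCat).obj U) ((godementPresheaf x N).obj U) :=
  godementModule x N U.unop

/-- The `𝒪_X`-module `U ↦ ∏ N l`, the product over those `l` with `x l ∈ U`, for a family of modules
`N l` over the stalks at points `x l`. -/
def godement : X.Modules where
  val := PresheafOfModules.ofPresheaf (R := X.presheaf ⋙ forget₂ CommRingCat RingCat)
    (godementPresheaf x N) (by
    intro U V f r m
    funext l
    exact congrArg (· • (show N l.1 from m ⟨l.1, f.unop.le l.2⟩))
      (TopCat.Presheaf.germ_res_apply' X.presheaf f (x l.1) l.2 r).symm)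
  isSheaf := godementPresheaf_isSheaf x N

/-- The component at `l` of a section of `godement x N`. -/
def godementEval {U : X.Opens} (l : Λ) (h : x l ∈ U) : Γ(godement x N, U) →+ N l where
  toFun s := (show ∀ l : {l // x l ∈ U}, N l.1 from s) ⟨l, h⟩
  map_zero' := rfl
  map_add' _ _ := rfl

@[simp]
lemma godementEval_smul {U : X.Opens} (l : Λ) (h : x l ∈ U) (f : Γ(X, U))
    (s : Γ(godement x N, U)) :
    godementEval x N l h (f • s) = X.presheaf.germ U (x l) h f • godementEval x N l h s := rfl

@[simp]
lemma godementEval_map {U V : X.Opens} (i : U ⟶ V) (l : Λ) (h : x l ∈ U)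
    (s : Γ(godement x N, V)) :
    godementEval x N l h ((godement x N).presheaf.map i.op s) = godementEval x N l (i.le h) s := rfl

variable {x N} in
lemma godement_ext {U : X.Opens} {s t : Γ(godement x N, U)}
    (h : ∀ l (hl : x l ∈ U), godementEval x N l hl s = godementEval x N l hl t) : s = t := by
  funext l
  exact h l.1 l.2

variable {x N} in
/-- A morphism of presheaves of modules into a Godement sheaf, given by its components. -/
def preToGodement {P : PresheafOfModules.{u} (X.presheaf ⋙ forget₂ CommRingCat RingCat)}
    (ψ : ∀ l (U : X.Opens) (_ : x l ∈ U), P.obj (op U) →+ N l)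
    (hsmul : ∀ l (U : X.Opens) (hl : x l ∈ U) (f : Γ(X, U)) (s : P.obj (op U)),
      ψ l U hl (f • s) = X.presheaf.germ U (x l) hl f • ψ l U hl s)
    (hmap : ∀ l (U V : X.Opens) (i : U ⟶ V) (hl : x l ∈ U) (s : P.obj (op V)),
      ψ l U hl (P.map i.op s) = ψ l V (i.le hl) s) :
    P ⟶ toPre (godement x N) :=
  PresheafOfModules.homMk
    { app := fun U => AddCommGrpCat.ofHom
        { toFun := fun s l => ψ l.1 U.unop l.2 s
          map_zero' := by funext l; exact map_zero _
          map_add' := fun s t => by funext l; exact map_add _ s t }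
      naturality := fun U V i => by
        ext s
        funext l
        exact hmap l.1 V.unop U.unop i.unop l.2 s }
    (fun U f s => by
      funext l
      exact hsmul l.1 U.unop l.2 f s)

variable {x N} in
/-- A morphism of `𝒪_X`-modules into a Godement sheaf, given by its components. -/
def toGodement {M : X.Modules}
    (ψ : ∀ l (U : X.Opens) (_ : x l ∈ U), Γ(M, U) →+ N l)
    (hsmul : ∀ l (U : X.Opens) (hl : x l ∈ U) (f : Γ(X, U)) (s : Γ(M, U)),
      ψ l U hl (f • s) = X.presheaf.germ U (x l) hl f • ψ l U hl s)
    (hmap : ∀ l (U V : X.Opens) (i : U ⟶ V) (hl : x l ∈ U) (s : Γ(M, V)),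
      ψ l U hl (M.presheaf.map i.op s) = ψ l V (i.le hl) s) :
    M ⟶ godement x N :=
  ⟨preToGodement (P := toPre M) ψ hsmul hmap⟩

end

/-! ### Germs, and skyscraper modules as test objects. -/

section

variable {X : Scheme.{u}}

/-- The stalk of an `𝒪_X`-module. -/
abbrev stalkModule (M : X.Modules) (p : X) : Type u :=
  ↑(TopCat.Presheaf.stalk (X := X.toTopCat) (toPre M).presheaf p)

/-- The germ of a section of an `𝒪_X`-module. -/
def germHom (M : X.Modules) (U : X.Opens) (p : X) (hp : p ∈ U) : Γ(M, U) →+ stalkModule M p :=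
  (TopCat.Presheaf.germ (X := X.toTopCat) (toPre M).presheaf U p hp).hom

lemma germHom_smul (M : X.Modules) (U : X.Opens) (p : X) (hp : p ∈ U) (f : Γ(X, U))
    (s : Γ(M, U)) :
    germHom M U p hp (f • s) = X.presheaf.germ U p hp f • germHom M U p hp s :=
  PresheafOfModules.germ_smul (X := X.toTopCat) (R := X.presheaf) (toPre M) p U hp f s

lemma germHom_map (M : X.Modules) {U V : X.Opens} (i : U ⟶ V) (p : X) (hp : p ∈ U)
    (s : Γ(M, V)) :
    germHom M U p hp (M.presheaf.map i.op s) = germHom M V p (i.le hp) s :=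
  TopCat.Presheaf.germ_res_apply (X := X.toTopCat) (toPre M).presheaf i p hp s

lemma germHom_eq (M : X.Modules) (p : X) {U V : X.Opens} (hU : p ∈ U) (hV : p ∈ V)
    (s : Γ(M, U)) (t : Γ(M, V)) (h : germHom M U p hU s = germHom M V p hV t) :
    ∃ (W : X.Opens) (_ : p ∈ W) (iU : W ⟶ U) (iV : W ⟶ V),
      M.presheaf.map iU.op s = M.presheaf.map iV.op t :=
  TopCat.Presheaf.germ_eq (X := X.toTopCat) (toPre M).presheaf p hU hV s t h

/-- A section that vanishes locally is zero. -/
lemma section_eq_zero (M : X.Modules) {U : X.Opens} (s : Γ(M, U))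
    (h : ∀ p ∈ U, ∃ (V : X.Opens) (_ : p ∈ V) (i : V ⟶ U), M.presheaf.map i.op s = 0) : s = 0 := by
  choose V hV i hi using h
  refine TopCat.Sheaf.eq_of_locally_eq' ⟨M.presheaf, M.isSheaf⟩ (fun p : U => V p.1 p.2) U
    (fun p => i p.1 p.2) (fun p hp => Opens.mem_iSup.2 ⟨⟨p, hp⟩, hV p hp⟩) s 0 ?_
  intro p
  refine (hi p.1 p.2).trans (map_zero _).symm

lemma section_eq_zero_of_germHom (M : X.Modules) {U : X.Opens} (s : Γ(M, U))
    (h : ∀ p (hp : p ∈ U), germHom M U p hp s = 0) : s = 0 := by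
  refine section_eq_zero M s fun p hp => ?_
  obtain ⟨W, hW, iU, iV, e⟩ := germHom_eq M p hp hp s 0 ((h p hp).trans (map_zero _).symm)
  exact ⟨W, hW, iU, e.trans (map_zero _)⟩

lemma hom_eq_zero {M N : X.Modules} (f : M ⟶ N) (h : ∀ U s, f.app U s = 0) : f = 0 := by
  ext U s
  exact h U s

lemma app_map {M N : X.Modules} (f : M ⟶ N) {U V : X.Opens} (i : U ⟶ V) (s : Γ(M, V)) :
    f.app U (M.presheaf.map i.op s) = N.presheaf.map i.op (f.app V s) :=
  ConcreteCategory.congr_hom (f.mapPresheaf.naturality i.op) s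

/-- The skyscraper module at a point with value a module over the stalk. -/
abbrev skyscraper (p : X) (N : Type u) [AddCommGroup N] [Module (X.presheaf.stalk p) N] :
    X.Modules :=
  godement (fun _ : PUnit.{u+1} => p) (fun _ => N)

/-- The morphism to a skyscraper module induced by a linear map from the stalk. -/
def toSkyscraper (M : X.Modules) (p : X) {N : Type u} [AddCommGroup N]
    [Module (X.presheaf.stalk p) N] (φ : stalkModule M p →ₗ[X.presheaf.stalk p] N) :
    M ⟶ skyscraper p N :=
  toGodement (fun _ U hp => φ.toAddMonoidHom.comp (germHom M U p hp))
    (fun _ U hp f s => by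
      change φ _ = _ • φ _
      rw [germHom_smul, map_smul])
    (fun _ U V i hp s => by
      change φ _ = φ _
      rw [germHom_map])

lemma godementEval_toSkyscraper (M : X.Modules) (p : X) {N : Type u} [AddCommGroup N]
    [Module (X.presheaf.stalk p) N] (φ : stalkModule M p →ₗ[X.presheaf.stalk p] N)
    (U : X.Opens) (hp : p ∈ U) (s : Γ(M, U)) :
    godementEval (fun _ : PUnit.{u+1} => p) (fun _ => N) PUnit.unit hp
      ((toSkyscraper M p φ).app U s) = φ (germHom M U p hp s) := rfl

/-- A morphism that vanishes in all stalks of the target is zero. -/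
lemma hom_eq_zero_of_toSkyscraper {M N : X.Modules} (f : M ⟶ N)
    (h : ∀ p : X, f ≫ toSkyscraper N p LinearMap.id = 0) : f = 0 := by
  refine hom_eq_zero f fun U s => section_eq_zero_of_germHom N _ fun p hp => ?_
  rw [← LinearMap.id_apply (R := X.presheaf.stalk p) (germHom N U p hp (f.app U s)),
    ← godementEval_toSkyscraper, ← ConcreteCategory.comp_apply, ← Scheme.Modules.Hom.comp_app, h p]
  rfl

/-- If a section `ζ` near `p` is such that any morphism to a skyscraper module at `p` that kills `ζ`
vanishes, then all sections near `p` are multiples of `ζ`. -/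
lemma exists_eq_smul_of_skyscraper (M : X.Modules) {p : X} {W₀ : X.Opens} (hp₀ : p ∈ W₀)
    (ζ : Γ(M, W₀))
    (h : ∀ (N : Type u) [AddCommGroup N] [Module (X.presheaf.stalk p) N]
      (ψ : M ⟶ skyscraper p N), ψ.app W₀ ζ = 0 → ψ = 0)
    {W : X.Opens} (hp : p ∈ W) (s : Γ(M, W)) :
    ∃ (V : X.Opens) (_ : p ∈ V) (i : V ⟶ W) (i₀ : V ⟶ W₀) (f : Γ(X, V)),
      M.presheaf.map i.op s = f • M.presheaf.map i₀.op ζ := by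
  -- The test morphism is passage to the stalk modulo the span of the germ of `ζ`. It kills `ζ`,
  -- hence everything, so every germ lies in that span.
  let S : Submodule (X.presheaf.stalk p) (stalkModule M p) :=
    Submodule.span _ {germHom M W₀ p hp₀ ζ}
  have h0 : toSkyscraper M p S.mkQ = 0 := by
    apply h
    refine godement_ext fun l hl => ?_
    exact (Submodule.Quotient.mk_eq_zero S).2 (Submodule.mem_span_singleton_self _)
  have h1 : germHom M W p hp s ∈ S := by
    rw [← Submodule.Quotient.mk_eq_zero, ← Submodule.mkQ_apply, ← godementEval_toSkyscraper, h0]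
    rfl
  obtain ⟨a, ha⟩ := Submodule.mem_span_singleton.1 h1
  obtain ⟨V, hV, f, rfl⟩ := TopCat.Presheaf.exists_germ_eq X.presheaf a
  have hV' : p ∈ V ⊓ W₀ := ⟨hV, hp₀⟩
  have e : germHom M W p hp s = germHom M (V ⊓ W₀) p hV'
      (X.presheaf.map (Opens.infLELeft V W₀).op f • M.presheaf.map (Opens.infLERight V W₀).op ζ) := by
    rw [germHom_smul, germHom_map, ← ha]
    congr 1
    exact (TopCat.Presheaf.germ_res_apply X.presheaf (Opens.infLELeft V W₀) p hV' f).symm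
  obtain ⟨W', hW', iU, iV, e'⟩ := germHom_eq M p hp hV' _ _ e
  refine ⟨W', hW', iU, iV ≫ Opens.infLERight V W₀,
    X.presheaf.map (iV ≫ Opens.infLELeft V W₀).op f, e'.trans ?_⟩
  rw [Scheme.Modules.map_smul, op_comp, op_comp, Functor.map_comp, Functor.map_comp]
  rfl

/-! ### Subobjects with locally the same sections -/

lemma mono_of_injective {M N : X.Modules} (f : M ⟶ N) (h : ∀ U s, f.app U s = 0 → s = 0) :
    Mono f := by
  refine Preadditive.mono_of_cancel_zero f fun {P} g hg => hom_eq_zero g fun U s => h U _ ?_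
  rw [← ConcreteCategory.comp_apply, ← Scheme.Modules.Hom.comp_app, hg]
  rfl

lemma comp_cokernel_eq_zero {M N G : X.Modules} (f : M ⟶ G) (g : N ⟶ G)
    (h : ∀ U (s : Γ(M, U)), ∀ p ∈ U, ∃ (V : X.Opens) (_ : p ∈ V) (i : V ⟶ U) (t : Γ(N, V)),
      f.app V (M.presheaf.map i.op s) = g.app V t) : f ≫ cokernel.π g = 0 := by
  refine hom_eq_zero _ fun U s => section_eq_zero _ _ fun p hp => ?_
  obtain ⟨V, hV, i, t, e⟩ := h U s p hp
  refine ⟨V, hV, i, ?_⟩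
  rw [← app_map, Scheme.Modules.Hom.comp_app, ConcreteCategory.comp_apply, e,
    ← ConcreteCategory.comp_apply, ← Scheme.Modules.Hom.comp_app, cokernel.condition]
  rfl

/-- Two submodules of an `𝒪_X`-module with locally the same sections are isomorphic. -/
lemma nonempty_iso_of_locally_eq {M N G : X.Modules} (f : M ⟶ G) (g : N ⟶ G) [Mono f] [Mono g]
    (h : ∀ U (s : Γ(M, U)), ∀ p ∈ U, ∃ (V : X.Opens) (_ : p ∈ V) (i : V ⟶ U) (t : Γ(N, V)),
      f.app V (M.presheaf.map i.op s) = g.app V t)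
    (h' : ∀ U (s : Γ(N, U)), ∀ p ∈ U, ∃ (V : X.Opens) (_ : p ∈ V) (i : V ⟶ U) (t : Γ(M, V)),
      g.app V (N.presheaf.map i.op s) = f.app V t) : Nonempty (M ≅ N) := by
  -- A monomorphism is the kernel of its cokernel, so each of `f` and `g` factors through the other
  -- as soon as it dies in the other's cokernel.
  have hf := Abelian.monoIsKernelOfCokernel _ (cokernelIsCokernel f)
  have hg := Abelian.monoIsKernelOfCokernel _ (cokernelIsCokernel g)
  let a : M ⟶ N := hg.lift (KernelFork.ofι f (comp_cokernel_eq_zero f g h))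
  let b : N ⟶ M := hf.lift (KernelFork.ofι g (comp_cokernel_eq_zero g f h'))
  have ha : a ≫ g = f := hg.fac _ WalkingParallelPair.zero
  have hb : b ≫ f = g := hf.fac _ WalkingParallelPair.zero
  exact ⟨⟨a, b, by rw [← cancel_mono f, Category.assoc, hb, ha, Category.id_comp],
    by rw [← cancel_mono g, Category.assoc, ha, hb, Category.id_comp]⟩⟩

end

section

variable {R : CommRingCat.{u}} {X Z : Scheme.{u}}

/-! ### Universal properties of sheafification and differentials -/

lemma sheafifyDesc_toSheafify {P : PresheafOfModules.{u} (X.presheaf ⋙ forget₂ CommRingCat RingCat)}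
    {M : X.Modules} (f : P ⟶ toPre M) (U : X.Opens) (s : P.obj (op U)) :
    (sheafifyDesc f).app U ((toSheafify X P).app (op U) s) = f.app (op U) s := by
  have h := (PresheafOfModules.sheafificationAdjunction
    (𝟙 X.ringCatSheaf.obj)).homEquiv_unit P M (sheafifyDesc f)
  have h2 := (Equiv.apply_symm_apply ((PresheafOfModules.sheafificationAdjunction
    (𝟙 X.ringCatSheaf.obj)).homEquiv P M) f).symm.trans h
  exact (congrArg (fun g : P ⟶ toPre M => g.app (op U) s) h2).symm

lemma sheafify_hom_ext {P : PresheafOfModules.{u} (X.presheaf ⋙ forget₂ CommRingCat RingCat)}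
    {M : X.Modules} {f g : sheafify X P ⟶ M}
    (h : ∀ (U : X.Opens) (s : P.obj (op U)),
      f.app U ((toSheafify X P).app (op U) s) = g.app U ((toSheafify X P).app (op U) s)) :
    f = g := by
  apply ((PresheafOfModules.sheafificationAdjunction
    (𝟙 X.ringCatSheaf.obj)).homEquiv P M).injective
  refine (Adjunction.homEquiv_unit _ _ _ f).trans (Eq.trans ?_ (Adjunction.homEquiv_unit _ _ _ g).symm)
  apply PresheafOfModules.hom_ext
  intro U
  ext s
  exact h U.unop s

/-- The section `d f` of `Ω_{X/R}`. -/
def dSection (a : X ⟶ Spec R) (U : X.Opens) : Γ(X, U) →+ Γ(omega a, U) :=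
  (omegaD a).d (X := op U)

lemma dSection_mul (a : X ⟶ Spec R) (U : X.Opens) (f g : Γ(X, U)) :
    dSection a U (f * g) = f • dSection a U g + g • dSection a U f :=
  (omegaD a).d_mul (X := op U) f g

lemma dSection_map (a : X ⟶ Spec R) {U V : X.Opens} (i : U ⟶ V) (f : Γ(X, V)) :
    dSection a U (X.presheaf.map i.op f) = (omega a).presheaf.map i.op (dSection a V f) :=
  (omegaD a).d_map i.op f

lemma omega_hom_ext {a : X ⟶ Spec R} {M : X.Modules} {f g : omega a ⟶ M}
    (h : ∀ (U : X.Opens) (s : Γ(X, U)), f.app U (dSection a U s) = g.app U (dSection a U s)) :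
    f = g := by
  refine sheafify_hom_ext fun U s => ?_
  have key : toSheafify X (preOmega a) ≫ f.val = toSheafify X (preOmega a) ≫ g.val := by
    refine (PresheafOfModules.DifferentialsConstruction.isUniversal'
      (constToPresheaf a)).postcomp_injective _ _ ?_
    ext U s
    exact h U.unop s
  exact congrArg (fun k : preOmega a ⟶ toPre M => k.app (op U) s) key

/-- The morphism from `Ω_{X/R}` given by a derivation. -/
def omegaDesc {a : X ⟶ Spec R} {M : X.Modules}
    (D : (toPre M).Derivation' (constToPresheaf a)) : omega a ⟶ M :=
  sheafifyDesc ((PresheafOfModules.DifferentialsConstruction.isUniversal'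
    (constToPresheaf a)).desc D)

lemma omegaDesc_dSection {a : X ⟶ Spec R} {M : X.Modules}
    (D : (toPre M).Derivation' (constToPresheaf a)) (U : X.Opens) (f : Γ(X, U)) :
    (omegaDesc D).app U (dSection a U f) = D.d (X := op U) f := by
  refine (sheafifyDesc_toSheafify _ U _).trans ?_
  exact PresheafOfModules.Derivation.congr_d
    ((PresheafOfModules.DifferentialsConstruction.isUniversal' (constToPresheaf a)).fac D) f

/-- The structure map from the base ring to a stalk. -/
def stalkConst (a : X ⟶ Spec R) (p : X) : R →+* X.presheaf.stalk p :=
  (X.presheaf.germ ⊤ p trivial).hom.comp ((constToPresheaf a).app (op ⊤)).hom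

lemma germ_constToPresheaf (a : X ⟶ Spec R) (U : X.Opens) (p : X) (hp : p ∈ U) (r : R) :
    X.presheaf.germ U p hp ((constToPresheaf a).app (op U) r) = stalkConst a p r := by
  have h : (constToPresheaf a).app (op U) r =
      X.presheaf.map (homOfLE le_top : U ⟶ ⊤).op ((constToPresheaf a).app (op ⊤) r) :=
    ConcreteCategory.congr_hom ((constToPresheaf a).naturality (homOfLE le_top : U ⟶ ⊤).op) r
  rw [h]
  exact TopCat.Presheaf.germ_res_apply X.presheaf _ p hp _

/-- The morphism from `Ω_{X/R}` to a Godement sheaf given by derivations of stalks. -/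
def omegaToGodement {Λ : Type u} {x : Λ → X} {N : Λ → Type u} [∀ l, AddCommGroup (N l)]
    [∀ l, Module (X.presheaf.stalk (x l)) (N l)] (a : X ⟶ Spec R)
    (δ : ∀ l, X.presheaf.stalk (x l) →+ N l)
    (hmul : ∀ l f g, δ l (f * g) = f • δ l g + g • δ l f)
    (hconst : ∀ l r, δ l (stalkConst a (x l) r) = 0) : omega a ⟶ godement x N :=
  omegaDesc
    { d := fun {U} => AddMonoidHom.mk' (fun f => show ∀ l : {l // x l ∈ U.unop}, N l.1 from
          fun l => δ l.1 (X.presheaf.germ U.unop (x l.1) l.2 f))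
          (fun f g => by
            funext l
            change δ l.1 _ = δ l.1 _ + δ l.1 _
            rw [map_add, map_add])
      d_mul := fun {U} f g => by
        funext l
        change δ l.1 (X.presheaf.germ U.unop (x l.1) l.2 (f * g)) = _
        rw [map_mul, hmul]; rfl
      d_map := fun {U V} i f => by
        funext l
        exact congrArg (δ l.1) (TopCat.Presheaf.germ_res_apply' X.presheaf i (x l.1) l.2 f)
      d_app := fun {U} r => by
        funext l
        exact (congrArg (δ l.1) (germ_constToPresheaf a U.unop (x l.1) l.2 r)).trans
          (hconst l.1 r) }

lemma godementEval_omegaToGodement {Λ : Type u} {x : Λ → X} {N : Λ → Type u}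
    [∀ l, AddCommGroup (N l)]
    [∀ l, Module (X.presheaf.stalk (x l)) (N l)] (a : X ⟶ Spec R)
    (δ : ∀ l, X.presheaf.stalk (x l) →+ N l) (hmul) (hconst)
    (U : X.Opens) (l : Λ) (hl : x l ∈ U) (f : Γ(X, U)) :
    godementEval x N l hl ((omegaToGodement a δ hmul hconst).app U (dSection a U f)) =
      δ l (X.presheaf.germ U (x l) hl f) := by
  rw [omegaToGodement, omegaDesc_dSection]
  rfl

/-! ### Universal property of the pullback -/

/-- The pullback of a section. -/
def pullbackSection (i : Z ⟶ X) (F : X.Modules) (U : X.Opens) :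
    Γ(F, U) →+ Γ((Scheme.Modules.pullback i).obj F, i ⁻¹ᵁ U) :=
  (((Scheme.Modules.pullbackPushforwardAdjunction i).unit.app F).app U).hom

lemma pullbackSection_smul (i : Z ⟶ X) (F : X.Modules) (U : X.Opens) (f : Γ(X, U))
    (s : Γ(F, U)) :
    pullbackSection i F U (f • s) = i.app U f • pullbackSection i F U s :=
  ((Scheme.Modules.pullbackPushforwardAdjunction i).unit.app F).app_smul f s

lemma pullbackSection_map (i : Z ⟶ X) (F : X.Modules) {U V : X.Opens} (j : U ⟶ V)
    (s : Γ(F, V)) :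
    pullbackSection i F U (F.presheaf.map j.op s) =
      ((Scheme.Modules.pullback i).obj F).presheaf.map ((Opens.map i.base).map j).op
        (pullbackSection i F V s) :=
  app_map ((Scheme.Modules.pullbackPushforwardAdjunction i).unit.app F) j s

lemma pullback_hom_ext {i : Z ⟶ X} {F : X.Modules} {M : Z.Modules}
    {f g : (Scheme.Modules.pullback i).obj F ⟶ M}
    (h : ∀ (U : X.Opens) (s : Γ(F, U)),
      f.app _ (pullbackSection i F U s) = g.app _ (pullbackSection i F U s)) : f = g := by
  apply ((Scheme.Modules.pullbackPushforwardAdjunction i).homEquiv F M).injective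
  rw [Adjunction.homEquiv_unit, Adjunction.homEquiv_unit]
  ext U s
  exact h U s

/-- The morphism from a pullback that is adjoint to a morphism to a pushforward. -/
def pullbackDesc {i : Z ⟶ X} {F : X.Modules} {M : Z.Modules}
    (f : F ⟶ (Scheme.Modules.pushforward i).obj M) : (Scheme.Modules.pullback i).obj F ⟶ M :=
  ((Scheme.Modules.pullbackPushforwardAdjunction i).homEquiv F M).symm f

lemma pullbackDesc_pullbackSection {i : Z ⟶ X} {F : X.Modules} {M : Z.Modules}
    (f : F ⟶ (Scheme.Modules.pushforward i).obj M) (U : X.Opens) (s : Γ(F, U)) :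
    (pullbackDesc f).app _ (pullbackSection i F U s) = f.app U s := by
  have h := (Scheme.Modules.pullbackPushforwardAdjunction i).homEquiv_unit F M (pullbackDesc f)
  rw [pullbackDesc, Equiv.apply_symm_apply] at h
  exact (congrArg (fun g : F ⟶ (Scheme.Modules.pushforward i).obj M => g.app U s) h).symm

lemma omegaMap_dSection (i : Z ⟶ X) (a : X ⟶ Spec R) (U : X.Opens) (f : Γ(X, U)) :
    (omegaMap i a).app U (dSection a U f) = dSection (i ≫ a) (i ⁻¹ᵁ U) (i.app U f) :=
  omegaDesc_dSection (pushforwardD i a) U f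

lemma omegaPullbackMap_apply (i : Z ⟶ X) (a : X ⟶ Spec R) (U : X.Opens) (f : Γ(X, U)) :
    (omegaPullbackMap i a).app _ (pullbackSection i _ U (dSection a U f)) =
      dSection (i ≫ a) (i ⁻¹ᵁ U) (i.app U f) :=
  (pullbackDesc_pullbackSection (omegaMap i a) U _).trans (omegaMap_dSection i a U f)

lemma omegaPullback_hom_ext {i : Z ⟶ X} {a : X ⟶ Spec R} {M : Z.Modules}
    {f g : (Scheme.Modules.pullback i).obj (omega a) ⟶ M}
    (h : ∀ (U : X.Opens) (s : Γ(X, U)),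
      f.app _ (pullbackSection i _ U (dSection a U s)) =
        g.app _ (pullbackSection i _ U (dSection a U s))) : f = g := by
  apply ((Scheme.Modules.pullbackPushforwardAdjunction i).homEquiv _ M).injective
  rw [Adjunction.homEquiv_unit, Adjunction.homEquiv_unit]
  exact omega_hom_ext h

end

section

variable {R : CommRingCat.{u}} {X Z : Scheme.{u}}

/-! ### Germs along immersions -/

lemma exists_opens_preimage_le (i : Z ⟶ X) [IsPreimmersion i] {p : Z} {V : Z.Opens} (hp : p ∈ V)
    {U : X.Opens} (hU : i p ∈ U) : ∃ (W : X.Opens) (_ : i p ∈ W), W ≤ U ∧ i ⁻¹ᵁ W ≤ V := by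
  obtain ⟨T, hT, e⟩ := i.isEmbedding.isInducing.isOpen_iff.1 V.isOpen
  have hpT : i p ∈ T := by
    have : p ∈ i ⁻¹' T := by rw [e]; exact hp
    exact this
  refine ⟨⟨T, hT⟩ ⊓ U, ⟨hpT, hU⟩, inf_le_right, fun q hq => ?_⟩
  have : q ∈ i ⁻¹' T := hq.1
  rw [e] at this
  exact this

lemma exists_germ_app_eq (i : Z ⟶ X) [IsPreimmersion i] (p : Z) (f : Z.presheaf.stalk p) :
    ∃ (U : X.Opens) (hU : p ∈ i ⁻¹ᵁ U) (g : Γ(X, U)),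
      Z.presheaf.germ (i ⁻¹ᵁ U) p hU (i.app U g) = f := by
  obtain ⟨t, rfl⟩ := i.stalkMap_surjective p f
  obtain ⟨U, hU, g, rfl⟩ := TopCat.Presheaf.exists_germ_eq X.presheaf t
  exact ⟨U, hU, g, (Scheme.Hom.germ_stalkMap_apply i U p hU g).symm⟩

lemma app_res (i : Z ⟶ X) {U V : X.Opens} (j : U ⟶ V) (g : Γ(X, V)) :
    i.app U (X.presheaf.map j.op g) =
      Z.presheaf.map ((Opens.map i.base).map j).op (i.app V g) :=
  ConcreteCategory.congr_hom (i.naturality j.op) g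

lemma res_res {U V W : X.Opens} (j : U ⟶ V) (k : V ⟶ W) (g : Γ(X, W)) :
    X.presheaf.map j.op (X.presheaf.map k.op g) = X.presheaf.map (j ≫ k).op g :=
  (ConcreteCategory.congr_hom (X.presheaf.map_comp k.op j.op) g).symm

lemma germ_res (p : X) {U V : X.Opens} (j : U ⟶ V) (hp : p ∈ U) (g : Γ(X, V)) :
    X.presheaf.germ U p hp (X.presheaf.map j.op g) = X.presheaf.germ V p (j.le hp) g :=
  TopCat.Presheaf.germ_res_apply X.presheaf j p hp g

/-- Equality of germs holds on an open subset of `Z`; since `Z` carries the induced topology, this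
subset may be shrunk to the trace of an open subset of `X`. -/
lemma exists_res_app_eq (i : Z ⟶ X) [IsPreimmersion i] {p : Z} {U V : X.Opens}
    (hU : p ∈ i ⁻¹ᵁ U) (hV : p ∈ i ⁻¹ᵁ V) (f : Γ(X, U)) (g : Γ(X, V))
    (h : Z.presheaf.germ (i ⁻¹ᵁ U) p hU (i.app U f) = Z.presheaf.germ (i ⁻¹ᵁ V) p hV (i.app V g)) :
    ∃ (W : X.Opens) (_ : p ∈ i ⁻¹ᵁ W) (jU : W ⟶ U) (jV : W ⟶ V),
      i.app W (X.presheaf.map jU.op f) = i.app W (X.presheaf.map jV.op g) := by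
  obtain ⟨T, hT, iU, iV, e⟩ := TopCat.Presheaf.germ_eq Z.presheaf p _ _ _ _ h
  obtain ⟨W, hW, hWU, hWT⟩ := exists_opens_preimage_le i hT (U := U ⊓ V) ⟨hU, hV⟩
  refine ⟨W, hW, homOfLE (hWU.trans inf_le_left), homOfLE (hWU.trans inf_le_right), ?_⟩
  have e' := congrArg (Z.presheaf.map (homOfLE hWT).op) e
  rw [res_res, res_res] at e'
  rw [app_res, app_res]
  exact e'

lemma app_constToPresheaf (i : Z ⟶ X) (a : X ⟶ Spec R) (U : X.Opens) (r : R) :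
    i.app U ((constToPresheaf a).app (op U) r) =
      (constToPresheaf (i ≫ a)).app (op (i ⁻¹ᵁ U)) r := by
  have h1 := ConcreteCategory.congr_hom (i.naturality (homOfLE le_top : U ⟶ ⊤).op)
    (a.appTop ((Scheme.ΓSpecIso R).inv r))
  refine h1.trans ?_
  simp [constToPresheaf]
  rfl

lemma germ_app_constToPresheaf (i : Z ⟶ X) (a : X ⟶ Spec R) (p : Z) (U : X.Opens)
    (hU : p ∈ i ⁻¹ᵁ U) (r : R) :
    Z.presheaf.germ (i ⁻¹ᵁ U) p hU (i.app U ((constToPresheaf a).app (op U) r)) =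
      stalkConst (i ≫ a) p r := by
  rw [app_constToPresheaf, germ_constToPresheaf]

lemma stalkMap_stalkConst (i : Z ⟶ X) (a : X ⟶ Spec R) (p : Z) (r : R) :
    i.stalkMap p (stalkConst a (i p) r) = stalkConst (i ≫ a) p r := by
  rw [← germ_app_constToPresheaf i a p ⊤ (Opens.mem_top _),
    ← germ_constToPresheaf a ⊤ (i p) (Opens.mem_top _)]
  exact Scheme.Hom.germ_stalkMap_apply i ⊤ p _ _

/-! ### Sections of ideal sheaves -/

/-- The functor of sections over an open set. -/
def sectionsFunctor (U : X.Opens) : X.Modules ⥤ Ab.{u} :=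
  Scheme.Modules.toPresheaf X ⋙ (evaluation X.Opensᵒᵖ Ab.{u}).obj (op U)

instance (U : X.Opens) : PreservesLimits (sectionsFunctor U) :=
  @comp_preservesLimits _ _ _ _ _ _ (Scheme.Modules.toPresheaf X)
    ((evaluation X.Opensᵒᵖ Ab.{u}).obj (op U)) inferInstance (evaluationPreservesLimits _)

instance (U : X.Opens) : (sectionsFunctor U).PreservesZeroMorphisms where
  map_zero _ _ := rfl

/-- Taking sections over an open set is left exact, because limits of modules are computed on
sections. -/
lemma exists_kernel_section {M N : X.Modules} (f : M ⟶ N) (U : X.Opens) (s : Γ(M, U))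
    (h : f.app U s = 0) : ∃ t : Γ(kernel f, U), (kernel.ι f).app U t = s := by
  let S : ShortComplex X.Modules := ShortComplex.mk (kernel.ι f) f (kernel.condition f)
  have hS : S.Exact := ShortComplex.exact_of_f_is_kernel _ (kernelIsKernel f)
  have hS' : (S.map (sectionsFunctor U)).Exact := hS.map_of_mono_of_preservesKernel (sectionsFunctor U) inferInstance inferInstance
  rw [ShortComplex.ab_exact_iff] at hS'
  exact hS' s h

lemma kernel_section_ext {M N : X.Modules} (f : M ⟶ N) {U : X.Opens} {s t : Γ(kernel f, U)}
    (h : (kernel.ι f).app U s = (kernel.ι f).app U t) : s = t := by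
  have : Mono ((sectionsFunctor U).map (kernel.ι f)) := inferInstance
  exact (AddCommGrpCat.mono_iff_injective _).1 this h

/-- The inclusion of the sections of an ideal sheaf. -/
def idealSection (I : X.IdealSheafData) (U : X.Opens) : Γ(idealModule I, U) →+ Γ(X, U) :=
  ((kernel.ι (structureMap I.subschemeι)).app U).hom

lemma idealSection_smul (I : X.IdealSheafData) (U : X.Opens) (f : Γ(X, U))
    (s : Γ(idealModule I, U)) : idealSection I U (f • s) = f * idealSection I U s :=
  (kernel.ι (structureMap I.subschemeι)).app_smul f s

lemma idealSection_map (I : X.IdealSheafData) {U V : X.Opens} (j : U ⟶ V)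
    (s : Γ(idealModule I, V)) :
    idealSection I U ((idealModule I).presheaf.map j.op s) =
      X.presheaf.map j.op (idealSection I V s) :=
  app_map (kernel.ι (structureMap I.subschemeι)) j s

lemma subschemeι_app_idealSection (I : X.IdealSheafData) (U : X.Opens)
    (s : Γ(idealModule I, U)) : I.subschemeι.app U (idealSection I U s) = 0 := by
  have h : (kernel.ι (structureMap I.subschemeι) ≫ structureMap I.subschemeι).app U s = 0 := by
    rw [kernel.condition]; rfl
  exact h

lemma exists_idealSection (I : X.IdealSheafData) (U : X.Opens) (f : Γ(X, U))
    (h : I.subschemeι.app U f = 0) : ∃ s, idealSection I U s = f :=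
  exists_kernel_section (structureMap I.subschemeι) U f h

lemma idealSection_injective (I : X.IdealSheafData) (U : X.Opens) :
    Function.Injective (idealSection I U) :=
  fun _ _ h => kernel_section_ext (structureMap I.subschemeι) h

/-- A morphism of `𝒪_X`-modules given by its action on sections. -/
def modulesHomMk {M N : X.Modules} (φ : ∀ U : X.Opens, Γ(M, U) →+ Γ(N, U))
    (hsmul : ∀ (U : X.Opens) (f : Γ(X, U)) (s : Γ(M, U)), φ U (f • s) = f • φ U s)
    (hmap : ∀ (U V : X.Opens) (j : U ⟶ V) (s : Γ(M, V)),
      φ U (M.presheaf.map j.op s) = N.presheaf.map j.op (φ V s)) : M ⟶ N :=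
  ⟨PresheafOfModules.homMk
    { app := fun U => AddCommGrpCat.ofHom (φ U.unop)
      naturality := fun U V j => by
        ext s
        exact hmap V.unop U.unop j.unop s }
    (fun U f s => hsmul U.unop f s)⟩

/-! ### The conormal sequence -/

/-- The morphism from an ideal sheaf `I` to `i_* i^* Ω_X` that sends `f` to `df`. -/
def idealToOmega (I : X.IdealSheafData) (a : X ⟶ Spec R) :
    idealModule I ⟶ (Scheme.Modules.pushforward I.subschemeι).obj
      ((Scheme.Modules.pullback I.subschemeι).obj (omega a)) :=
  modulesHomMk (fun U => (pullbackSection I.subschemeι (omega a) U).comp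
      ((dSection a U).comp (idealSection I U)))
    (fun U f s => by
      change pullbackSection _ _ U (dSection a U (idealSection I U (f • s))) =
        I.subschemeι.app U f • pullbackSection I.subschemeι (omega a) U (dSection a U (idealSection I U s))
      -- In d(fs) = f ds + s df the second term vanishes on V(I), because s lies in the ideal. This
      -- is what makes d linear on the ideal after restriction.
      rw [idealSection_smul, dSection_mul, map_add, pullbackSection_smul, pullbackSection_smul,
        subschemeι_app_idealSection, zero_smul, add_zero])
    (fun U V j s => by
      change pullbackSection _ _ U (dSection a U
        (idealSection I U ((idealModule I).presheaf.map j.op s))) = _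
      rw [idealSection_map, dSection_map, pullbackSection_map]
      rfl)

/-- The morphism `i^* I ⟶ i^* Ω_X` that sends `f` to `df`. -/
def conormalToOmega (I : X.IdealSheafData) (a : X ⟶ Spec R) :
    (Scheme.Modules.pullback I.subschemeι).obj (idealModule I) ⟶
      (Scheme.Modules.pullback I.subschemeι).obj (omega a) :=
  pullbackDesc (idealToOmega I a)

lemma conormalToOmega_apply (I : X.IdealSheafData) (a : X ⟶ Spec R) (U : X.Opens)
    (s : Γ(idealModule I, U)) :
    (conormalToOmega I a).app _ (pullbackSection I.subschemeι (idealModule I) U s) =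
      pullbackSection I.subschemeι (omega a) U (dSection a U (idealSection I U s)) :=
  pullbackDesc_pullbackSection (idealToOmega I a) U s

lemma conormalToOmega_comp (I : X.IdealSheafData) (a : X ⟶ Spec R) :
    conormalToOmega I a ≫ omegaPullbackMap I.subschemeι a = 0 := by
  refine pullback_hom_ext fun U s => ?_
  rw [Scheme.Modules.Hom.comp_app, ConcreteCategory.comp_apply, conormalToOmega_apply,
    omegaPullbackMap_apply, subschemeι_app_idealSection, map_zero]
  rfl

/-- Functions on `Z` lift locally to `X`, so the differentials of functions from `X` generate those
of `Z`, and a morphism that kills the former is zero. -/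
lemma epi_omegaPullbackMap (i : Z ⟶ X) [IsPreimmersion i] (a : X ⟶ Spec R) :
    Epi (omegaPullbackMap i a) := by
  refine Preadditive.epi_of_cancel_zero _ fun {M} g hg => omega_hom_ext fun U s => ?_
  have h0 : ∀ (V : X.Opens) (t : Γ(X, V)), g.app _ (dSection (i ≫ a) (i ⁻¹ᵁ V) (i.app V t)) = 0 := by
    intro V t
    rw [← omegaPullbackMap_apply, ← ConcreteCategory.comp_apply, ← Scheme.Modules.Hom.comp_app, hg]
    rfl
  change _ = 0
  refine section_eq_zero M _ fun p hp => ?_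
  obtain ⟨V, hV, t, ht⟩ := exists_germ_app_eq i p (Z.presheaf.germ U p hp s)
  obtain ⟨W, hW, j₁, j₂, e⟩ := TopCat.Presheaf.germ_eq Z.presheaf p _ _ _ _ ht
  refine ⟨W, hW, j₂, ?_⟩
  rw [← app_map, ← dSection_map]
  refine (congrArg (fun x => g.app W (dSection (i ≫ a) W x)) e).symm.trans ?_
  change g.app W (dSection (i ≫ a) W (Z.presheaf.map j₁.op _)) = 0
  rw [dSection_map, app_map, h0, map_zero]

section

variable (I : X.IdealSheafData) (a : X ⟶ Spec R) {Q : I.subscheme.Modules}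
  (q : (Scheme.Modules.pullback I.subschemeι).obj (omega a) ⟶ Q)

/-- Two lifts of the same germ differ near `p` by a section of `I`, whose differential is killed by
`q`. Hence a germ on V(I) can be differentiated through an arbitrary lift to `X`. -/
lemma germHom_eq_of_conormal (hq : conormalToOmega I a ≫ q = 0) (p : I.subscheme)
    {U V : X.Opens} (hU : p ∈ I.subschemeι ⁻¹ᵁ U) (hV : p ∈ I.subschemeι ⁻¹ᵁ V) (f : Γ(X, U)) (g : Γ(X, V))
    (h : I.subscheme.presheaf.germ (I.subschemeι ⁻¹ᵁ U) p hU (I.subschemeι.app U f) =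
      I.subscheme.presheaf.germ (I.subschemeι ⁻¹ᵁ V) p hV (I.subschemeι.app V g)) :
    germHom Q _ p hU (q.app _ (pullbackSection I.subschemeι _ U (dSection a U f))) =
      germHom Q _ p hV (q.app _ (pullbackSection I.subschemeι _ V (dSection a V g))) := by
  obtain ⟨W, hW, jU, jV, e⟩ := exists_res_app_eq I.subschemeι hU hV f g h
  obtain ⟨s, hs⟩ := exists_idealSection I W (X.presheaf.map jU.op f - X.presheaf.map jV.op g)
    (by rw [map_sub, e, sub_self])
  have h1 : q.app _ (pullbackSection I.subschemeι _ W (dSection a W (idealSection I W s))) = 0 := by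
    rw [← conormalToOmega_apply, ← ConcreteCategory.comp_apply, ← Scheme.Modules.Hom.comp_app, hq]
    rfl
  have h2 : ∀ {U : X.Opens} (hU : p ∈ I.subschemeι ⁻¹ᵁ U) (j : W ⟶ U) (f : Γ(X, U)),
      germHom Q _ p hW (q.app _ (pullbackSection I.subschemeι _ W
        (dSection a W (X.presheaf.map j.op f)))) =
      germHom Q _ p hU (q.app _ (pullbackSection I.subschemeι _ U (dSection a U f))) := by
    intro U hU j f
    rw [dSection_map, pullbackSection_map, app_map, germHom_map]
  rw [← h2 hU jU f, ← h2 hV jV g, ← sub_eq_zero, ← map_sub, ← map_sub, ← map_sub, ← map_sub, ← hs,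
    h1, map_zero]

/-- The derivation of the stalk of `V(I)` induced by a morphism from `i^* Ω_X` that
vanishes on `I`. -/
def conormalStalkFun (p : I.subscheme) (f : I.subscheme.presheaf.stalk p) : stalkModule Q p :=
  germHom Q _ p (exists_germ_app_eq I.subschemeι p f).choose_spec.choose
    (q.app _ (pullbackSection I.subschemeι _ _ (dSection a _
      (exists_germ_app_eq I.subschemeι p f).choose_spec.choose_spec.choose)))

variable {a q}

lemma conormalStalkFun_germ (hq : conormalToOmega I a ≫ q = 0) (p : I.subscheme)
    {U : X.Opens} (hU : p ∈ I.subschemeι ⁻¹ᵁ U) (f : Γ(X, U)) :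
    conormalStalkFun I a q p
      (I.subscheme.presheaf.germ (I.subschemeι ⁻¹ᵁ U) p hU (I.subschemeι.app U f)) =
    germHom Q _ p hU (q.app _ (pullbackSection I.subschemeι _ U (dSection a U f))) :=
  germHom_eq_of_conormal I a q hq p _ _ _ _
    (exists_germ_app_eq I.subschemeι p _).choose_spec.choose_spec.choose_spec

lemma exists_germ_app_eq₂ (i : Z ⟶ X) [IsPreimmersion i] (p : Z) (f g : Z.presheaf.stalk p) :
    ∃ (U : X.Opens) (hU : p ∈ i ⁻¹ᵁ U) (f' g' : Γ(X, U)),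
      Z.presheaf.germ (i ⁻¹ᵁ U) p hU (i.app U f') = f ∧
      Z.presheaf.germ (i ⁻¹ᵁ U) p hU (i.app U g') = g := by
  obtain ⟨U, hU, f', rfl⟩ := exists_germ_app_eq i p f
  obtain ⟨V, hV, g', rfl⟩ := exists_germ_app_eq i p g
  refine ⟨U ⊓ V, ⟨hU, hV⟩, X.presheaf.map (Opens.infLELeft U V).op f',
    X.presheaf.map (Opens.infLERight U V).op g', ?_, ?_⟩
  · rw [app_res]
    exact germ_res p _ _ _
  · rw [app_res]
    exact germ_res p _ _ _

/-- The morphism from `Ω_{V(I)}` to a skyscraper module induced by a morphism from `i^* Ω_X` that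
vanishes on `I`. -/
def conormalToSkyscraper (hq : conormalToOmega I a ≫ q = 0) (p : I.subscheme) :
    omega (I.subschemeι ≫ a) ⟶ skyscraper p (stalkModule Q p) :=
  omegaToGodement (I.subschemeι ≫ a)
    (fun _ => AddMonoidHom.mk' (conormalStalkFun I a q p) (fun f g => by
      obtain ⟨U, hU, f, g, rfl, rfl⟩ := exists_germ_app_eq₂ I.subschemeι p f g
      rw [← map_add, ← map_add, conormalStalkFun_germ I hq, conormalStalkFun_germ I hq,
        conormalStalkFun_germ I hq, map_add, map_add, map_add, map_add]))
    (fun _ f g => by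
      obtain ⟨U, hU, f, g, rfl, rfl⟩ := exists_germ_app_eq₂ I.subschemeι p f g
      change conormalStalkFun I a q p _ = _ • conormalStalkFun I a q p _ +
        _ • conormalStalkFun I a q p _
      rw [← map_mul, ← map_mul, conormalStalkFun_germ I hq, conormalStalkFun_germ I hq,
        conormalStalkFun_germ I hq, dSection_mul, map_add, map_add, map_add, pullbackSection_smul,
        pullbackSection_smul, Scheme.Modules.Hom.app_smul, Scheme.Modules.Hom.app_smul,
        germHom_smul, germHom_smul])
    (fun _ r => by
      change conormalStalkFun I a q p _ = 0
      have hp : p ∈ I.subschemeι ⁻¹ᵁ ⊤ := Opens.mem_top _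
      rw [← germ_app_constToPresheaf I.subschemeι a p ⊤ hp, conormalStalkFun_germ I hq]
      have h0 : dSection a ⊤ ((constToPresheaf a).app (op ⊤) r) = 0 :=
        (omegaD a).d_app r
      rw [h0, map_zero, map_zero, map_zero])

lemma comp_conormalToSkyscraper (hq : conormalToOmega I a ≫ q = 0) (p : I.subscheme) :
    omegaPullbackMap I.subschemeι a ≫ conormalToSkyscraper I hq p =
      q ≫ toSkyscraper Q p LinearMap.id := by
  refine omegaPullback_hom_ext fun U s => ?_
  refine godement_ext fun l hl => ?_
  rw [Scheme.Modules.Hom.comp_app, ConcreteCategory.comp_apply, omegaPullbackMap_apply]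
  refine (godementEval_omegaToGodement _ _ _ _ _ _ _ _).trans ?_
  exact conormalStalkFun_germ I hq p hl s

end

/-- The conormal sequence `i^* I ⟶ i^* Ω_X ⟶ Ω_{V(I)}` is exact. -/
lemma conormal_exact (I : X.IdealSheafData) (a : X ⟶ Spec R) :
    (ShortComplex.mk (conormalToOmega I a) (omegaPullbackMap I.subschemeι a)
      (conormalToOmega_comp I a)).Exact := by
  rw [ShortComplex.exact_iff_kernel_ι_comp_cokernel_π_zero]
  -- Taking `q` to be the cokernel of the first map, its projection followed by passage to a stalk
  -- factors through the differentials of V(I), and therefore kills the kernel of the second map.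
  refine hom_eq_zero_of_toSkyscraper _ fun p => ?_
  dsimp only
  rw [Category.assoc, ← comp_conormalToSkyscraper I (cokernel.condition _) p,
    kernel.condition_assoc, zero_comp]

end

section

variable {X : Scheme.{u}}

/-! ### Tensor products of sections -/

open MonoidalCategory in
/-- The tensor product of sections of presheaves of modules. -/
def preTensorSection (M N : X.Modules) (U : X.Opens) (s : Γ(M, U)) (t : Γ(N, U)) :
    (toPre M ⊗ toPre N).obj (op U) :=
  show ↑((toPre M).obj (op U) ⊗ (toPre N).obj (op U)) from
    TensorProduct.tmul Γ(X, U) (show (toPre M).obj (op U) from s) (show (toPre N).obj (op U) from t)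

/-- The section `s ⊗ t` of `M ⊗ N`. -/
def tensorSection {M N : X.Modules} {U : X.Opens} (s : Γ(M, U)) (t : Γ(N, U)) :
    Γ(tensor M N, U) :=
  (toSheafify X _).app (op U) (preTensorSection M N U s t)

lemma tensorSection_map {M N : X.Modules} {U V : X.Opens} (i : U ⟶ V) (s : Γ(M, V))
    (t : Γ(N, V)) :
    (tensor M N).presheaf.map i.op (tensorSection s t) =
      tensorSection (M.presheaf.map i.op s) (N.presheaf.map i.op t) := by
  refine (PresheafOfModules.naturality_apply (toSheafify X _) i.op
    (preTensorSection M N V s t)).symm.trans ?_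
  rfl

lemma smul_tensorSection_smul {M N : X.Modules} {U : X.Opens} (f g : Γ(X, U)) (s : Γ(M, U))
    (t : Γ(N, U)) :
    tensorSection (f • s) (g • t) = (f * g) • tensorSection s t := by
  have h : preTensorSection M N U (f • s) (g • t) = (f * g) • preTensorSection M N U s t :=
    TensorProduct.smul_tmul_smul (R := Γ(X, U)) f g (show (toPre M).obj (op U) from s)
      (show (toPre N).obj (op U) from t)
  rw [tensorSection, h]
  exact ((toSheafify X _).app (op U)).hom.map_smul (f * g) _

lemma preTensor_addHom_ext {M N : X.Modules} {U : X.Opens} {A : Type*} [AddCommGroup A]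
    {F G : (MonoidalCategory.tensorObj (toPre M) (toPre N)).obj (op U) →+ A}
    (h : ∀ s t, F (preTensorSection M N U s t) = G (preTensorSection M N U s t)) : F = G := by
  ext y
  induction y using TensorProduct.induction_on with
  | zero => exact (map_zero F).trans (map_zero G).symm
  | tmul s t => exact h s t
  | add x y hx hy => exact (map_add F x y).trans ((congr (congrArg _ hx) hy).trans (map_add G x y).symm)

lemma tensor_hom_ext {M N P : X.Modules} {f g : tensor M N ⟶ P}
    (h : ∀ (U : X.Opens) (s : Γ(M, U)) (t : Γ(N, U)),
      f.app U (tensorSection s t) = g.app U (tensorSection s t)) : f = g := by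
  refine sheafify_hom_ext fun U x => ?_
  let F (k : tensor M N ⟶ P) :
      (MonoidalCategory.tensorObj (toPre M) (toPre N)).obj (op U) →+ Γ(P, U) :=
    (k.app U).hom.comp ((toSheafify X (MonoidalCategory.tensorObj (toPre M) (toPre N))).app
      (op U)).hom.toAddMonoidHom
  have key : F f = F g := preTensor_addHom_ext (h U)
  exact DFunLike.congr_fun key x

variable {Λ : Type u} (x : Λ → X)

/-- The morphism from the structure sheaf to the product of its stalks at a family of points. -/
def unitToGodement : structureModule X ⟶ godement x (fun l => X.presheaf.stalk (x l)) :=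
  toGodement (fun l U hl => (X.presheaf.germ U (x l) hl).hom.toAddMonoidHom)
    (fun l U hl f s => map_mul (X.presheaf.germ U (x l) hl).hom f s)
    (fun l _ _ i hl s => germ_res (x l) i hl s)

variable {x}

/-- The components of a morphism to a Godement sheaf. -/
def godementComponent {N : Λ → Type u} [∀ l, AddCommGroup (N l)]
    [∀ l, Module (X.presheaf.stalk (x l)) (N l)] {M : X.Modules} (f : M ⟶ godement x N) (l : Λ)
    (U : X.Opens) (hl : x l ∈ U) : Γ(M, U) →+ N l :=
  (godementEval x N l hl).comp (f.app U).hom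

section

variable {N : Λ → Type u} [∀ l, AddCommGroup (N l)]
    [∀ l, Module (X.presheaf.stalk (x l)) (N l)] {M : X.Modules} (f : M ⟶ godement x N) (l : Λ)

lemma godementComponent_smul {U : X.Opens} (hl : x l ∈ U) (r : Γ(X, U)) (s : Γ(M, U)) :
    godementComponent f l U hl (r • s) =
      X.presheaf.germ U (x l) hl r • godementComponent f l U hl s := by
  change godementEval x N l hl (f.app U (r • s)) = _
  rw [Scheme.Modules.Hom.app_smul, godementEval_smul]
  rfl

lemma godementComponent_map {U V : X.Opens} (i : U ⟶ V) (hl : x l ∈ U) (s : Γ(M, V)) :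
    godementComponent f l U hl (M.presheaf.map i.op s) = godementComponent f l V (i.le hl) s := by
  change godementEval x N l hl (f.app U (M.presheaf.map i.op s)) = _
  rw [app_map, godementEval_map]
  rfl

lemma godement_hom_ext {f g : M ⟶ godement x N}
    (h : ∀ l U hl s, godementComponent f l U hl s = godementComponent g l U hl s) : f = g := by
  ext U s
  exact godement_ext fun l hl => h l U hl s

end

/-- The components of the product of two morphisms to the product of the stalks. -/
def preTensorComponent {M N : X.Modules} (f : M ⟶ godement x (fun l => X.presheaf.stalk (x l)))
    (g : N ⟶ godement x (fun l => X.presheaf.stalk (x l))) (l : Λ) (U : X.Opens) (hl : x l ∈ U) :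
    (MonoidalCategory.tensorObj (toPre M) (toPre N)).obj (op U) →+ X.presheaf.stalk (x l) :=
  TensorProduct.liftAddHom (R := Γ(X, U)) (M := (toPre M).obj (op U)) (N := (toPre N).obj (op U))
    ((AddMonoidHom.mul.comp (godementComponent f l U hl)).compl₂ (godementComponent g l U hl))
    (fun r s t => by
      change godementComponent f l U hl (r • (show Γ(M, U) from s)) *
          godementComponent g l U hl (show Γ(N, U) from t) =
        godementComponent f l U hl (show Γ(M, U) from s) *
          godementComponent g l U hl (r • (show Γ(N, U) from t))
      rw [godementComponent_smul, godementComponent_smul, smul_eq_mul, smul_eq_mul]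
      ring)

/-- The product of two morphisms to the product of the stalks of the structure sheaf. -/
def tensorToGodement {M N : X.Modules} (f : M ⟶ godement x (fun l => X.presheaf.stalk (x l)))
    (g : N ⟶ godement x (fun l => X.presheaf.stalk (x l))) :
    tensor M N ⟶ godement x (fun l => X.presheaf.stalk (x l)) :=
  sheafifyDesc (preToGodement (P := MonoidalCategory.tensorObj (toPre M) (toPre N))
    (preTensorComponent f g)
    (fun l U hl r y => by
      have key : (preTensorComponent f g l U hl).comp (DistribSMul.toAddMonoidHom _ r) =
          (DistribSMul.toAddMonoidHom _ (X.presheaf.germ U (x l) hl r)).comp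
            (preTensorComponent f g l U hl) := by
        refine preTensor_addHom_ext fun s t => ?_
        change godementComponent f l U hl (r • s) * godementComponent g l U hl t =
          X.presheaf.germ U (x l) hl r • (godementComponent f l U hl s *
            godementComponent g l U hl t)
        rw [godementComponent_smul, smul_eq_mul, smul_eq_mul, mul_assoc]
      exact DFunLike.congr_fun key y)
    (fun l U V i hl y => by
      have key : (preTensorComponent f g l U hl).comp
          ((MonoidalCategory.tensorObj (toPre M) (toPre N)).map i.op).hom.toAddMonoidHom =
          preTensorComponent f g l V (i.le hl) := by
        refine preTensor_addHom_ext fun s t => ?_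
        change godementComponent f l U hl (M.presheaf.map i.op s) *
            godementComponent g l U hl (N.presheaf.map i.op t) =
          godementComponent f l V (i.le hl) s * godementComponent g l V (i.le hl) t
        rw [godementComponent_map, godementComponent_map]
      exact DFunLike.congr_fun key y))

lemma godementComponent_tensorToGodement {M N : X.Modules}
    (f : M ⟶ godement x (fun l => X.presheaf.stalk (x l)))
    (g : N ⟶ godement x (fun l => X.presheaf.stalk (x l))) (l : Λ) (U : X.Opens) (hl : x l ∈ U)
    (s : Γ(M, U)) (t : Γ(N, U)) :
    godementComponent (tensorToGodement f g) l U hl (tensorSection s t) =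
      godementComponent f l U hl s * godementComponent g l U hl t :=
  congrArg (godementEval x (fun l => X.presheaf.stalk (x l)) l hl) (sheafifyDesc_toSheafify _ U _)

/-- The `k`-th power of a morphism to the product of the stalks of the structure sheaf. -/
def tensorPowToGodement {L : X.Modules} (g : L ⟶ godement x (fun l => X.presheaf.stalk (x l))) :
    ∀ k, tensorPow L k ⟶ godement x (fun l => X.presheaf.stalk (x l))
  | 0 => unitToGodement x
  | k + 1 => tensorToGodement (tensorPowToGodement g k) g

/-- The `k`-th tensor power of a section. -/
def tensorPowSection {L : X.Modules} {U : X.Opens} (e : Γ(L, U)) : ∀ k, Γ(tensorPow L k, U)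
  | 0 => show Γ(X, U) from 1
  | k + 1 => tensorSection (tensorPowSection e k) e

lemma godementComponent_tensorPowToGodement {L : X.Modules}
    (g : L ⟶ godement x (fun l => X.presheaf.stalk (x l))) (l : Λ) (U : X.Opens) (hl : x l ∈ U)
    (e : Γ(L, U)) (k : ℕ) :
    godementComponent (tensorPowToGodement g k) l U hl (tensorPowSection e k) =
      godementComponent g l U hl e ^ k := by
  induction k with
  | zero =>
    rw [pow_zero]
    exact map_one (X.presheaf.germ U (x l) hl).hom
  | succ k ih =>
    rw [pow_succ, ← ih]
    exact godementComponent_tensorToGodement _ _ _ _ _ _ _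

lemma modules_res_res (M : X.Modules) {U V W : X.Opens} (j : U ⟶ V) (k : V ⟶ W) (s : Γ(M, W)) :
    M.presheaf.map j.op (M.presheaf.map k.op s) = M.presheaf.map (j ≫ k).op s :=
  (ConcreteCategory.congr_hom (M.presheaf.map_comp k.op j.op) s).symm

/-- A section of an `𝒪_X`-module generates it near a point. -/
def GeneratesAt (M : X.Modules) {W : X.Opens} (ζ : Γ(M, W)) (p : X) : Prop :=
  ∀ (U : X.Opens) (_ : p ∈ U) (s : Γ(M, U)), ∃ (V : X.Opens) (_ : p ∈ V) (i : V ⟶ U) (i₀ : V ⟶ W)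
    (f : Γ(X, V)), M.presheaf.map i.op s = f • M.presheaf.map i₀.op ζ

/-- Sections of a sheafified tensor product are not explicit, so the skyscraper criterion is used: a
morphism is determined on pure tensors, and near `p` these are multiples of `ζ ⊗ e`. -/
lemma GeneratesAt.tensorSection {M N : X.Modules} {W : X.Opens} {ζ : Γ(M, W)} {e : Γ(N, W)} {p : X}
    (hp : p ∈ W) (hζ : GeneratesAt M ζ p) (he : GeneratesAt N e p) :
    GeneratesAt (tensor M N) (tensorSection ζ e) p := by
  intro U hU s
  refine exists_eq_smul_of_skyscraper _ hp _ (fun Q _ _ ψ hψ => tensor_hom_ext fun U s t => ?_) hU s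
  refine godement_ext fun l hl => ?_
  obtain ⟨V, hV, i, i₀, f, e₁⟩ := hζ U hl s
  obtain ⟨V', hV', j, j₀, g, e₂⟩ := he V hV (N.presheaf.map i.op t)
  have h₀ : j ≫ i₀ = j₀ := Subsingleton.elim _ _
  have e₃ : (tensor M N).presheaf.map (j ≫ i).op (MultipleCurve.tensorSection s t) =
      (X.presheaf.map j.op f * g) • (tensor M N).presheaf.map j₀.op
        (MultipleCurve.tensorSection ζ e) := by
    rw [tensorSection_map, tensorSection_map, ← smul_tensorSection_smul, ← e₂, ← h₀,
      ← modules_res_res M j i, e₁, Scheme.Modules.map_smul, modules_res_res M j i₀,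
      modules_res_res N j i]
  have e₄ := congrArg (fun y => godementComponent ψ l V' hV' y) e₃
  dsimp only at e₄
  rw [godementComponent_map, godementComponent_smul, godementComponent_map] at e₄
  refine Eq.trans e₄ ?_
  have e₅ : godementComponent ψ l W hp (MultipleCurve.tensorSection ζ e) = 0 := by
    exact congrArg (godementEval (fun _ : PUnit.{u+1} => p) (fun _ => Q) l hp) hψ
  rw [e₅, smul_zero]
  rfl

lemma GeneratesAt.tensorPowSection {L : X.Modules} {W : X.Opens} {e : Γ(L, W)} {p : X}
    (hp : p ∈ W) (he : GeneratesAt L e p) (k : ℕ) :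
    GeneratesAt (tensorPow L k) (tensorPowSection e k) p := by
  induction k with
  | zero =>
    intro U hU s
    refine ⟨U ⊓ W, ⟨hU, hp⟩, Opens.infLELeft U W, Opens.infLERight U W,
      X.presheaf.map (Opens.infLELeft U W).op s, ?_⟩
    change X.presheaf.map (Opens.infLELeft U W).op s = X.presheaf.map (Opens.infLELeft U W).op s *
      X.presheaf.map (Opens.infLERight U W).op 1
    rw [map_one, mul_one]
  | succ k ih => exact ih.tensorSection hp he

end

section

variable {X Z : Scheme.{u}}

/-! ### Local generators -/

section

variable {Λ : Type u} {x : Λ → X} {N : Λ → Type u} [∀ l, AddCommGroup (N l)]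
    [∀ l, Module (X.presheaf.stalk (x l)) (N l)] {M : X.Modules}

lemma godementComponent_eq_of_germHom (f : M ⟶ godement x N) (l : Λ) {U V : X.Opens} (hU : x l ∈ U)
    (hV : x l ∈ V) {s : Γ(M, U)} {t : Γ(M, V)}
    (h : germHom M U (x l) hU s = germHom M V (x l) hV t) :
    godementComponent f l U hU s = godementComponent f l V hV t := by
  obtain ⟨W, hW, i, j, e⟩ := germHom_eq M (x l) hU hV s t h
  rw [← godementComponent_map f l i hW, e, godementComponent_map]

lemma GeneratesAt.exists_germHom {W : X.Opens} {e : Γ(M, W)} {p : X} (hp : p ∈ W)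
    (he : GeneratesAt M e p) {U : X.Opens} (hU : p ∈ U) (s : Γ(M, U)) :
    ∃ a : X.presheaf.stalk p, germHom M U p hU s = a • germHom M W p hp e := by
  obtain ⟨V, hV, i, i₀, f, h⟩ := he U hU s
  refine ⟨X.presheaf.germ V p hV f, ?_⟩
  rw [← germHom_map M i p hV, h, germHom_smul, germHom_map]

lemma godementComponent_eq_smul (f : M ⟶ godement x N) (l : Λ) {U V : X.Opens} (hU : x l ∈ U)
    (hV : x l ∈ V) {s : Γ(M, U)} {t : Γ(M, V)} {a : X.presheaf.stalk (x l)}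
    (h : germHom M U (x l) hU s = a • germHom M V (x l) hV t) :
    godementComponent f l U hU s = a • godementComponent f l V hV t := by
  obtain ⟨W, hW, r, rfl⟩ := TopCat.Presheaf.exists_germ_eq X.presheaf a
  have hWV : x l ∈ W ⊓ V := ⟨hW, hV⟩
  have e : germHom M U (x l) hU s = germHom M (W ⊓ V) (x l) hWV
      (X.presheaf.map (Opens.infLELeft W V).op r • M.presheaf.map (Opens.infLERight W V).op t) := by
    rw [germHom_smul, germHom_map, h, germ_res]
  rw [godementComponent_eq_of_germHom f l hU hWV e, godementComponent_smul, godementComponent_map,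
    germ_res]

end

lemma GeneratesAt.res {M : X.Modules} {W W' : X.Opens} {e : Γ(M, W)} {p : X}
    (he : GeneratesAt M e p) (j : W' ⟶ W) (hp : p ∈ W') :
    GeneratesAt M (M.presheaf.map j.op e) p := by
  intro U hU s
  obtain ⟨V, hV, i, i₀, f, h⟩ := he U hU s
  refine ⟨V ⊓ W', ⟨hV, hp⟩, Opens.infLELeft V W' ≫ i, Opens.infLERight V W',
    X.presheaf.map (Opens.infLELeft V W').op f, ?_⟩
  rw [modules_res_res, ← modules_res_res M (Opens.infLELeft V W') i, h, Scheme.Modules.map_smul,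
    modules_res_res]
  rfl

/-- Sections of `N` need not be lifted: a morphism from `N` to a skyscraper is determined by its
composite with `q`, and that composite is determined by its value on `e`. -/
lemma GeneratesAt.of_epi {M N : X.Modules} (q : M ⟶ N) [Epi q] {W : X.Opens} {e : Γ(M, W)} {p : X}
    (hp : p ∈ W) (he : GeneratesAt M e p) : GeneratesAt N (q.app W e) p := by
  intro U hU s
  refine exists_eq_smul_of_skyscraper _ hp _ (fun Q _ _ ψ hψ => ?_) hU s
  rw [← cancel_epi q, comp_zero]
  refine godement_hom_ext fun l V hV t => ?_
  obtain ⟨a, ha⟩ := he.exists_germHom hp hV t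
  rw [godementComponent_eq_smul (q ≫ ψ) l hV hp ha]
  have : godementComponent (q ≫ ψ) l W hp e = 0 :=
    congrArg (godementEval (fun _ : PUnit.{u+1} => p) (fun _ => Q) l hp) hψ
  rw [this, smul_zero]
  rfl

lemma GeneratesAt.pullback {M : X.Modules} (i : Z ⟶ X) {W : X.Opens} {e : Γ(M, W)} {p : Z}
    (hp : p ∈ i ⁻¹ᵁ W) (he : GeneratesAt M e (i p)) :
    GeneratesAt ((Scheme.Modules.pullback i).obj M) (pullbackSection i M W e) p := by
  intro U hU s
  refine exists_eq_smul_of_skyscraper _ hp _ (fun Q _ _ ψ hψ => pullback_hom_ext fun V t => ?_) hU s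
  refine godement_ext fun l hV => ?_
  change godementComponent ψ l _ hV _ = 0
  obtain ⟨V', hV', j, j₀, f, h⟩ := he V hV t
  have hV'' : p ∈ i ⁻¹ᵁ V' := hV'
  have h1 := congrArg (pullbackSection i M V') h
  rw [pullbackSection_smul, pullbackSection_map, pullbackSection_map] at h1
  have h2 := congrArg (godementComponent ψ l _ hV'') h1
  rw [godementComponent_smul] at h2
  refine (godementComponent_map ψ l ((Opens.map i.base).map j) hV'' _).symm.trans (h2.trans ?_)
  have : godementComponent ψ l _ hV'' (((Scheme.Modules.pullback i).obj M).presheaf.map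
      ((Opens.map i.base).map j₀).op (pullbackSection i M W e)) = 0 :=
    (godementComponent_map ψ l ((Opens.map i.base).map j₀) hV'' _).trans
      (congrArg (godementEval (fun _ : PUnit.{u+1} => p) (fun _ => Q) l hp) hψ)
  exact (congrArg _ this).trans (smul_zero _)

/-- The coefficient supplied on `Z` has to come from a function on `X`; it does near the point, as
stalk maps of a preimmersion are surjective. -/
lemma GeneratesAt.pushforward {M : Z.Modules} (i : Z ⟶ X) [IsPreimmersion i] {W : X.Opens}
    {e : Γ(M, i ⁻¹ᵁ W)} {p : Z} (hp : p ∈ i ⁻¹ᵁ W) (he : GeneratesAt M e p) :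
    GeneratesAt ((Scheme.Modules.pushforward i).obj M) (W := W) e (i p) := by
  intro U hU s
  obtain ⟨V, hV, j, j₀, f, h⟩ := he (i ⁻¹ᵁ U) hU s
  obtain ⟨V₁, hV₁, g, hg⟩ := exists_germ_app_eq i p (Z.presheaf.germ V p hV f)
  obtain ⟨T, hT, k₁, k₂, hk⟩ := TopCat.Presheaf.germ_eq Z.presheaf p hV₁ hV _ _ hg
  obtain ⟨V₂, hV₂, hle, hle'⟩ := exists_opens_preimage_le i hT (U := V₁ ⊓ (U ⊓ W)) ⟨hV₁, hU, hp⟩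
  refine ⟨V₂, hV₂, homOfLE (hle.trans (inf_le_right.trans inf_le_left)),
    homOfLE (hle.trans (inf_le_right.trans inf_le_right)),
    X.presheaf.map (homOfLE (hle.trans inf_le_left)).op g, ?_⟩
  have h1 := congrArg (M.presheaf.map (homOfLE (hle'.trans k₂.le)).op) h
  rw [Scheme.Modules.map_smul, modules_res_res M _ j₀] at h1
  refine (modules_res_res M (homOfLE (hle'.trans k₂.le)) j s).symm.trans (h1.trans ?_)
  have h2 : Z.presheaf.map (homOfLE (hle'.trans k₂.le)).op f =
      i.app V₂ (X.presheaf.map (homOfLE (hle.trans inf_le_left)).op g) := by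
    rw [app_res]
    have h3 := congrArg (Z.presheaf.map (homOfLE hle').op) hk
    rw [res_res, res_res] at h3
    exact h3.symm
  rw [h2]
  rfl

lemma generatesAt_idealModule (I : X.IdealSheafData) {W : X.Opens} (e : Γ(idealModule I, W)) {p : X}
    (hp : p ∈ W) (h : ∀ (U : X.Opens) (hU : p ∈ U) (s : Γ(idealModule I, U)),
      X.presheaf.germ W p hp (idealSection I W e) ∣ X.presheaf.germ U p hU (idealSection I U s)) :
    GeneratesAt (idealModule I) e p := by
  intro U hU s
  obtain ⟨a, ha⟩ := h U hU s
  obtain ⟨V, hV, f, rfl⟩ := TopCat.Presheaf.exists_germ_eq X.presheaf a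
  have hVW : p ∈ V ⊓ W := ⟨hV, hp⟩
  have h1 : X.presheaf.germ U p hU (idealSection I U s) = X.presheaf.germ (V ⊓ W) p hVW
      (X.presheaf.map (Opens.infLELeft V W).op f *
        X.presheaf.map (Opens.infLERight V W).op (idealSection I W e)) := by
    rw [map_mul, germ_res, germ_res, ha, mul_comm]
  obtain ⟨T, hT, i, j, e'⟩ := TopCat.Presheaf.germ_eq X.presheaf p _ _ _ _ h1
  refine ⟨T, hT, i, j ≫ Opens.infLERight V W, X.presheaf.map (j ≫ Opens.infLELeft V W).op f, ?_⟩
  apply idealSection_injective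
  rw [idealSection_map, idealSection_smul, idealSection_map]
  refine e'.trans ?_
  rw [map_mul, res_res, res_res]

/-! ### Jacobson spaces -/

/-- The part of `U` outside `T` is locally closed, and in a Jacobson space a nonempty locally closed
set contains a closed point. Thus local statements need checking only at closed points. -/
lemma mem_of_closedPoints [JacobsonSpace X] {U : X.Opens} {T : Set X} (hT : IsOpen T)
    (h : ∀ p ∈ U, IsClosed {p} → p ∈ T) : ∀ p ∈ U, p ∈ T := by
  by_contra! hcon
  obtain ⟨p, hp, hpT⟩ := hcon
  have hlc : IsLocallyClosed ((U : Set X) ∩ Tᶜ) :=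
    U.isOpen.isLocallyClosed.inter hT.isClosed_compl.isLocallyClosed
  obtain ⟨q, hq, hq'⟩ := nonempty_inter_closedPoints (Z := (U : Set X) ∩ Tᶜ) ⟨p, hp, hpT⟩ hlc
  exact hq.2 (h q hq.1 hq')

lemma exists_opens_of_closedPoints [JacobsonSpace X] {U : X.Opens} {P : X.Opens → Prop}
    (h : ∀ p ∈ U, IsClosed {p} → ∃ (V : X.Opens) (_ : p ∈ V), P V) :
    ∀ p ∈ U, ∃ (V : X.Opens) (_ : p ∈ V), P V := by
  intro p hp
  have := mem_of_closedPoints (U := U) (T := ⋃ (V : X.Opens) (_ : P V), (V : Set X))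
    (isOpen_iUnion fun V => isOpen_iUnion fun _ => V.isOpen) (fun q hq hq' => by
      obtain ⟨V, hV, hPV⟩ := h q hq hq'
      exact Set.mem_iUnion₂.2 ⟨V, hPV, hV⟩) p hp
  obtain ⟨V, hPV, hV⟩ := Set.mem_iUnion₂.1 this
  exact ⟨V, hV, hPV⟩

lemma section_eq_zero_of_closedPoints [JacobsonSpace X] (M : X.Modules) {U : X.Opens} (s : Γ(M, U))
    (h : ∀ p (hp : p ∈ U), IsClosed {p} → germHom M U p hp s = 0) : s = 0 := by
  refine section_eq_zero M s fun p hp => ?_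
  obtain ⟨V, hV, i, e⟩ := exists_opens_of_closedPoints
    (P := fun V => ∃ i : V ⟶ U, M.presheaf.map i.op s = 0) (fun p hp hp' => by
      obtain ⟨W, hW, iU, iV, e⟩ := germHom_eq M p hp hp s 0 ((h p hp hp').trans (map_zero _).symm)
      exact ⟨W, hW, iU, e.trans (map_zero _)⟩) p hp
  exact ⟨V, hV, i, e⟩

/-! ### Comparison of modules with local generators -/

section

variable {Λ : Type u} {x : Λ → X} {N : Λ → Type u} [∀ l, AddCommGroup (N l)]
    [∀ l, Module (X.presheaf.stalk (x l)) (N l)] {M M' : X.Modules}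

/-- The germ of a section at `x l` is a multiple `a • e` of the generator. If its image vanishes
then `a` kills the image of `e`, hence kills `e` itself by hypothesis. -/
lemma mono_of_generatesAt [JacobsonSpace X] (hx : ∀ p : X, IsClosed {p} → ∃ l, x l = p)
    (f : M ⟶ godement x N)
    (h : ∀ l, ∃ (W : X.Opens) (hl : x l ∈ W) (e : Γ(M, W)), GeneratesAt M e (x l) ∧
      ∀ a : X.presheaf.stalk (x l), a • godementComponent f l W hl e = 0 →
        a • germHom M W (x l) hl e = 0) : Mono f := by
  refine mono_of_injective f fun U s hs => section_eq_zero_of_closedPoints M s fun p hp hp' => ?_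
  obtain ⟨l, rfl⟩ := hx p hp'
  obtain ⟨W, hl, e, he, ha⟩ := h l
  obtain ⟨a, hae⟩ := he.exists_germHom hl hp s
  rw [hae]
  apply ha
  rw [← godementComponent_eq_smul f l hp hl hae]
  exact congrArg (godementEval x N l hp) hs

lemma locally_eq_of_generatesAt [JacobsonSpace X] (hx : ∀ p : X, IsClosed {p} → ∃ l, x l = p)
    {G : X.Modules} (f : M ⟶ G) (g : M' ⟶ G)
    (h : ∀ l, ∃ (W : X.Opens) (_ : x l ∈ W) (e : Γ(M, W)) (e' : Γ(M', W)), GeneratesAt M e (x l) ∧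
      f.app W e = g.app W e') :
    ∀ U (s : Γ(M, U)), ∀ p ∈ U, ∃ (V : X.Opens) (_ : p ∈ V) (i : V ⟶ U) (t : Γ(M', V)),
      f.app V (M.presheaf.map i.op s) = g.app V t := by
  intro U s
  refine exists_opens_of_closedPoints (P := fun V => ∃ (i : V ⟶ U) (t : Γ(M', V)),
    f.app V (M.presheaf.map i.op s) = g.app V t) fun p hp hp' => ?_
  obtain ⟨l, rfl⟩ := hx p hp'
  obtain ⟨W, hl, e, e', he, hee⟩ := h l
  obtain ⟨V, hV, i, i₀, r, hr⟩ := he U hp s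
  refine ⟨V, hV, i, r • M'.presheaf.map i₀.op e', ?_⟩
  rw [hr, Scheme.Modules.Hom.app_smul, Scheme.Modules.Hom.app_smul, app_map, app_map, hee]

/-- Two submodules of a Godement sheaf at the closed points that have the same local generators are
isomorphic. -/
lemma mono_and_nonempty_iso_of_generatesAt [JacobsonSpace X]
    (hx : ∀ p : X, IsClosed {p} → ∃ l, x l = p) (f : M ⟶ godement x N) (g : M' ⟶ godement x N)
    (h : ∀ l, ∃ (W : X.Opens) (hl : x l ∈ W) (e : Γ(M, W)) (e' : Γ(M', W)),
      GeneratesAt M e (x l) ∧ GeneratesAt M' e' (x l) ∧ f.app W e = g.app W e' ∧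
      ∀ a : X.presheaf.stalk (x l), a • godementComponent f l W hl e = 0 →
        a • germHom M W (x l) hl e = 0 ∧ a • germHom M' W (x l) hl e' = 0) :
    Mono f ∧ Mono g ∧ Nonempty (M ≅ M') := by
  have hf : Mono f := mono_of_generatesAt hx f fun l => by
    obtain ⟨W, hl, e, e', he, he', hee, ha⟩ := h l
    exact ⟨W, hl, e, he, fun a h0 => (ha a h0).1⟩
  have hg : Mono g := mono_of_generatesAt hx g fun l => by
    obtain ⟨W, hl, e, e', he, he', hee, ha⟩ := h l
    refine ⟨W, hl, e', he', fun a h0 => (ha a ?_).2⟩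
    have : godementComponent f l W hl e = godementComponent g l W hl e' :=
      congrArg (godementEval x N l hl) hee
    rw [this, h0]
  refine ⟨hf, hg, nonempty_iso_of_locally_eq f g
    (locally_eq_of_generatesAt hx f g fun l => ?_) (locally_eq_of_generatesAt hx g f fun l => ?_)⟩
  · obtain ⟨W, hl, e, e', he, he', hee, ha⟩ := h l
    exact ⟨W, hl, e, e', he, hee⟩
  · obtain ⟨W, hl, e, e', he, he', hee, ha⟩ := h l
    exact ⟨W, hl, e', e, he', hee.symm⟩

end

end

section

variable {X T : Scheme.{u}}

/-! ### Stalks of ideal sheaves -/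

lemma germ_app_eq_of_eq {f g : T ⟶ X} (e : f = g) (U : X.Opens) (p : T) (hp : p ∈ f ⁻¹ᵁ U)
    (hp' : g p ∈ U) (s : Γ(X, U)) :
    T.presheaf.germ (f ⁻¹ᵁ U) p hp (f.app U s) = g.stalkMap p (X.presheaf.germ U (g p) hp' s) := by
  subst e
  exact (Scheme.Hom.germ_stalkMap_apply f U p hp s).symm

lemma app_eq_zero_of_eq {f g : T ⟶ X} (e : f = g) {U : X.Opens} {s : Γ(X, U)}
    (h : f.app U s = 0) : g.app U s = 0 := by
  subst e; exact h

section

variable (I : X.IdealSheafData) {g : I.subscheme ⟶ X} (hg : I.subschemeι = g)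

include hg in
-- On an affine open set the ideal of `I ^ k` is the `k`-th power of the ideal of `I`. The morphism
-- `g` is only equal to the closed immersion, so that it can later be a composite through V(I^m) and
-- the stalks at its points have the form needed there.
lemma germ_mem_ker_pow (k : ℕ) (p : I.subscheme) {U : X.Opens} (hp : g p ∈ U) (f : Γ(X, U))
    (hf : (I ^ k).subschemeι.app U f = 0) :
    X.presheaf.germ U (g p) hp f ∈ RingHom.ker (g.stalkMap p).hom ^ k := by
  obtain ⟨V, hV, hpV, hVU'⟩ := exists_isAffineOpen_mem_and_subset hp
  have hVU : V ≤ U := hVU'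
  have h1 : X.presheaf.map (homOfLE hVU).op f ∈ (I ^ k).ideal ⟨V, hV⟩ := by
    rw [← (I ^ k).ker_subschemeι_app]
    change (I ^ k).subschemeι.app V (X.presheaf.map (homOfLE hVU).op f) = 0
    rw [app_res, hf, map_zero]
  have h2 : (I.ideal ⟨V, hV⟩).map (X.presheaf.germ V (g p) hpV).hom ≤
      RingHom.ker (g.stalkMap p).hom := by
    rw [Ideal.map_le_iff_le_comap]
    intro s hs
    have hs' : I.subschemeι.app V s = 0 := by
      rw [← I.ker_subschemeι_app] at hs
      exact hs
    change g.stalkMap p (X.presheaf.germ V (g p) hpV s) = 0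
    have hp' : p ∈ I.subschemeι ⁻¹ᵁ V := by rw [hg]; exact hpV
    rw [← germ_app_eq_of_eq hg V p hp', hs', map_zero]
  have h3 := Ideal.mem_map_of_mem (X.presheaf.germ V (g p) hpV).hom h1
  change _ ∈ Ideal.map _ (I.ideal ⟨V, hV⟩ ^ k) at h3
  rw [Ideal.map_pow] at h3
  have h4 := Ideal.pow_right_mono h2 k h3
  rw [← germ_res (g p) (homOfLE hVU) hpV f]
  exact h4

include hg in
lemma exists_mem_ideal (p : I.subscheme) {z : X.presheaf.stalk (g p)} (hz : g.stalkMap p z = 0) :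
    ∃ (U : X.affineOpens) (hp : g p ∈ U.1) (f : Γ(X, U.1)), f ∈ I.ideal U ∧
      X.presheaf.germ U.1 (g p) hp f = z := by
  obtain ⟨U, hU, f, rfl⟩ := TopCat.Presheaf.exists_germ_eq X.presheaf z
  have hU' : p ∈ g ⁻¹ᵁ U := hU
  have : IsPreimmersion g := hg ▸ inferInstance
  rw [← germ_app_eq_of_eq rfl U p hU'] at hz
  obtain ⟨W, hW, j₁, j₂, e⟩ := exists_res_app_eq g hU' hU' f 0 (by rw [hz, map_zero, map_zero])
  rw [map_zero, map_zero] at e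
  obtain ⟨V, hV, hpV, hVW'⟩ := exists_isAffineOpen_mem_and_subset (x := g p) (U := W) hW
  have hVW : V ≤ W := hVW'
  refine ⟨⟨V, hV⟩, hpV, X.presheaf.map (homOfLE hVW ≫ j₁).op f, ?_, germ_res _ _ _ _⟩
  rw [← I.ker_subschemeι_app]
  refine app_eq_zero_of_eq hg.symm ?_
  change g.app V (X.presheaf.map (homOfLE hVW ≫ j₁).op f) = 0
  rw [← res_res, app_res, e, map_zero]

end

lemma subschemeι_pow_app_eq_zero (I : X.IdealSheafData) (k : ℕ) {U : X.affineOpens} {f : Γ(X, U.1)}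
    (hf : f ∈ I.ideal U) : (I ^ k).subschemeι.app U.1 (f ^ k) = 0 := by
  have h : f ^ k ∈ (I ^ k).ideal U := Ideal.pow_mem_pow hf k
  rw [← (I ^ k).ker_subschemeι_app] at h
  exact h

/-! ### The conormal sheaf -/

/-- The section of the conormal sheaf given by a section of the ideal sheaf. -/
def conormalSection (I : X.IdealSheafData) (U : X.Opens) (s : Γ(idealModule I, U)) :
    Γ(conormal I, I.subschemeι ⁻¹ᵁ U) :=
  pullbackSection I.subschemeι _ U
    ((cokernel.π (idealInclusion (pow_le_self I two_ne_zero))).app U s)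

lemma generatesAt_conormalSection (I : X.IdealSheafData) {U : X.Opens} {s : Γ(idealModule I, U)}
    {p : I.subscheme} (hp : p ∈ I.subschemeι ⁻¹ᵁ U)
    (h : GeneratesAt (idealModule I) s (I.subschemeι p)) :
    GeneratesAt (conormal I) (conormalSection I U s) p :=
  (h.of_epi (cokernel.π (idealInclusion (pow_le_self I two_ne_zero)))
    (show I.subschemeι p ∈ U from hp)).pullback I.subschemeι hp

section

variable (I : X.IdealSheafData) {g : I.subscheme ⟶ X} (hg : I.subschemeι = g) {Λ : Type u}
  (x : Λ → I.subscheme) (c : ∀ l, X.presheaf.stalk (g (x l)) →+ I.subscheme.presheaf.stalk (x l))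
  (hc : ∀ l a b, c l (a * b) = g.stalkMap (x l) a * c l b + g.stalkMap (x l) b * c l a)

include hg in
lemma mem_preimage_of_eq {p : I.subscheme} {U : X.Opens} (hp : p ∈ I.subschemeι ⁻¹ᵁ U) :
    g p ∈ U := by
  subst hg; exact hp

include hg in
lemma stalkMap_germ_idealSection {p : I.subscheme} {U : X.Opens} (hp : p ∈ I.subschemeι ⁻¹ᵁ U)
    (hp' : g p ∈ U) (s : Γ(idealModule I, U)) :
    g.stalkMap p (X.presheaf.germ U (g p) hp' (idealSection I U s)) = 0 := by
  rw [← germ_app_eq_of_eq hg U p hp, subschemeι_app_idealSection, map_zero]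

/-- The morphism from an ideal sheaf to a product of stalks given by derivations of stalks. -/
def idealToGodement : idealModule I ⟶ (Scheme.Modules.pushforward I.subschemeι).obj
    (godement x (fun l => I.subscheme.presheaf.stalk (x l))) :=
  modulesHomMk
    (fun U => AddMonoidHom.mk' (fun s => show ∀ l : {l // x l ∈ I.subschemeι ⁻¹ᵁ U},
        I.subscheme.presheaf.stalk (x l.1) from fun l =>
          c l.1 (X.presheaf.germ U (g (x l.1)) (mem_preimage_of_eq I hg l.2) (idealSection I U s)))
      (fun s t => by
        funext l
        change c l.1 _ = c l.1 _ + c l.1 _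
        rw [map_add, map_add, map_add]))
    (fun U f s => by
      funext l
      change c l.1 _ = I.subscheme.presheaf.germ _ (x l.1) l.2 (I.subschemeι.app U f) * c l.1 _
      rw [idealSection_smul, map_mul, hc, stalkMap_germ_idealSection I hg l.2, zero_mul, add_zero]
      exact congrArg (· * _) (germ_app_eq_of_eq hg U (x l.1) l.2 (mem_preimage_of_eq I hg l.2) f).symm)
    (fun U V j s => by
      funext l
      change c l.1 _ = c l.1 _
      rw [idealSection_map, germ_res])

/-- The morphism from the conormal sheaf to a product of stalks given by derivations of stalks. -/
def conormalToGodement : conormal I ⟶ godement x (fun l => I.subscheme.presheaf.stalk (x l)) :=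
  pullbackDesc (cokernel.desc _ (idealToGodement I hg x c hc) (by
    refine hom_eq_zero _ fun U s => ?_
    funext l
    change c l.1 (X.presheaf.germ U (g (x l.1)) (mem_preimage_of_eq I hg l.2)
      (idealSection I U ((idealInclusion (pow_le_self I two_ne_zero)).app U s))) = 0
    have h1 : idealSection I U ((idealInclusion (pow_le_self I two_ne_zero)).app U s) =
        idealSection (I ^ 2) U s := by
      have h := kernel.lift_ι (structureMap I.subschemeι) _
        (idealModule_condition (pow_le_self I two_ne_zero))
      exact congrArg (fun k : idealModule (I ^ 2) ⟶ structureModule X => k.app U s) h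
    rw [h1]
    -- Germs of I² are sums of products of two elements of the kernel of the stalk map, and the
    -- derivation `c` kills such products by the Leibniz rule.
    have h2 := germ_mem_ker_pow I hg 2 (x l.1) (mem_preimage_of_eq I hg l.2) _
      (subschemeι_app_idealSection (I ^ 2) U s)
    rw [pow_two] at h2
    refine Submodule.mul_induction_on h2 (fun a ha b hb => ?_) (fun a b ha hb => ?_)
    · have ha' : g.stalkMap (x l.1) a = 0 := ha
      have hb' : g.stalkMap (x l.1) b = 0 := hb
      rw [hc, ha', hb', zero_mul, zero_mul, add_zero]
    · rw [map_add, ha, hb, add_zero]))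

lemma godementComponent_conormalToGodement (l : Λ) (U : X.Opens) (hl : x l ∈ I.subschemeι ⁻¹ᵁ U)
    (s : Γ(idealModule I, U)) :
    godementComponent (conormalToGodement I hg x c hc) l _ hl (conormalSection I U s) =
      c l (X.presheaf.germ U (g (x l)) (mem_preimage_of_eq I hg hl) (idealSection I U s)) := by
  have h0 : ∀ (h : idealInclusion (pow_le_self I two_ne_zero) ≫ idealToGodement I hg x c hc = 0),
      godementComponent (pullbackDesc (cokernel.desc _ (idealToGodement I hg x c hc) h)) l _ hl
        (conormalSection I U s) =
      c l (X.presheaf.germ U (g (x l)) (mem_preimage_of_eq I hg hl) (idealSection I U s)) := by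
    intro h
    have h1 := pullbackDesc_pullbackSection (i := I.subschemeι) (cokernel.desc _
      (idealToGodement I hg x c hc) h) U
      ((cokernel.π (idealInclusion (pow_le_self I two_ne_zero))).app U s)
    have h2 := congrArg (fun k : idealModule I ⟶ _ => k.app U s)
      (cokernel.π_desc _ (idealToGodement I hg x c hc) h)
    exact congrArg (godementEval x _ l hl) (h1.trans h2)
  exact h0 _

end

end

section

variable {X Z : Scheme.{u}}

/-! ### Annihilators of germs -/

lemma exists_smul_res_eq_zero {M : X.Modules} {W : X.Opens} {p : X} (hp : p ∈ W) {e : Γ(M, W)}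
    {a : X.presheaf.stalk p} (h : a • germHom M W p hp e = 0) :
    ∃ (V : X.Opens) (hV : p ∈ V) (j : V ⟶ W) (f : Γ(X, V)),
      X.presheaf.germ V p hV f = a ∧ f • M.presheaf.map j.op e = 0 := by
  obtain ⟨U, hU, f, rfl⟩ := TopCat.Presheaf.exists_germ_eq X.presheaf a
  have hUW : p ∈ U ⊓ W := ⟨hU, hp⟩
  have h1 : germHom M (U ⊓ W) p hUW
      (X.presheaf.map (Opens.infLELeft U W).op f • M.presheaf.map (Opens.infLERight U W).op e) =
      germHom M (U ⊓ W) p hUW 0 := by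
    rw [germHom_smul, germHom_map, germ_res, h, map_zero]
  obtain ⟨V, hV, j, j', h2⟩ := germHom_eq M p hUW hUW _ _ h1
  refine ⟨V, hV, j ≫ Opens.infLERight U W, X.presheaf.map (j ≫ Opens.infLELeft U W).op f,
    germ_res _ _ _ _, ?_⟩
  rw [map_zero, Scheme.Modules.map_smul, modules_res_res, res_res] at h2
  exact h2

lemma stalkMap_smul_germHom_pullbackSection_eq_zero (i : Z ⟶ X) {M : X.Modules} {W : X.Opens}
    {p : Z} (hp : p ∈ i ⁻¹ᵁ W) (hp' : i p ∈ W) {e : Γ(M, W)} {a : X.presheaf.stalk (i p)}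
    (h : a • germHom M W (i p) hp' e = 0) :
    i.stalkMap p a •
      germHom ((Scheme.Modules.pullback i).obj M) _ p hp (pullbackSection i M W e) = 0 := by
  obtain ⟨V, hV, j, f, rfl, h1⟩ := exists_smul_res_eq_zero hp' h
  have h2 := congrArg (pullbackSection i M V) h1
  rw [pullbackSection_smul, pullbackSection_map, map_zero] at h2
  have hV' : p ∈ i ⁻¹ᵁ V := hV
  have h3 := congrArg (germHom ((Scheme.Modules.pullback i).obj M) _ p hV') h2
  rw [germHom_smul, map_zero] at h3
  rw [← germ_app_eq_of_eq rfl V p hV' hV]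
  refine Eq.trans ?_ h3
  congr 1
  exact (germHom_map ((Scheme.Modules.pullback i).obj M) ((Opens.map i.base).map j) p hV' _).symm

lemma smul_germHom_pushforward_eq_zero (i : Z ⟶ X) [IsPreimmersion i] {M : Z.Modules} {W : X.Opens}
    {p : Z} (hp : i p ∈ W) (e : Γ(M, i ⁻¹ᵁ W)) {a : X.presheaf.stalk (i p)}
    (h : i.stalkMap p a = 0) :
    a • germHom ((Scheme.Modules.pushforward i).obj M) W (i p) hp e = 0 := by
  obtain ⟨U, hU, f, rfl⟩ := TopCat.Presheaf.exists_germ_eq X.presheaf a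
  have hU' : p ∈ i ⁻¹ᵁ U := hU
  rw [← germ_app_eq_of_eq rfl U p hU' hU] at h
  obtain ⟨V, hV, j₁, j₂, h1⟩ := exists_res_app_eq i hU' hU' f 0 (by rw [h, map_zero, map_zero])
  rw [map_zero, map_zero] at h1
  have hVW : i p ∈ V ⊓ W := ⟨hV, hp⟩
  have h2 : i.app (V ⊓ W) (X.presheaf.map (Opens.infLELeft V W ≫ j₁).op f) = 0 := by
    rw [← res_res, app_res, h1, map_zero]
  have h3 : X.presheaf.map (Opens.infLELeft V W ≫ j₁).op f •
      ((Scheme.Modules.pushforward i).obj M).presheaf.map (Opens.infLERight V W).op e = 0 := by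
    change i.app (V ⊓ W) (X.presheaf.map (Opens.infLELeft V W ≫ j₁).op f) •
      M.presheaf.map ((Opens.map i.base).map (Opens.infLERight V W)).op e = 0
    rw [h2, zero_smul]
  have h4 := congrArg (germHom ((Scheme.Modules.pushforward i).obj M) _ (i p) hVW) h3
  rw [germHom_smul, map_zero, germ_res] at h4
  refine Eq.trans ?_ h4
  congr 1
  exact (germHom_map ((Scheme.Modules.pushforward i).obj M) (Opens.infLERight V W) (i p) hVW e).symm

lemma smul_germHom_idealModule_eq_zero (I : X.IdealSheafData) {W : X.Opens} {p : X} (hp : p ∈ W)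
    {e : Γ(idealModule I, W)} {a : X.presheaf.stalk p}
    (h : a * X.presheaf.germ W p hp (idealSection I W e) = 0) :
    a • germHom (idealModule I) W p hp e = 0 := by
  obtain ⟨U, hU, f, rfl⟩ := TopCat.Presheaf.exists_germ_eq X.presheaf a
  have hUW : p ∈ U ⊓ W := ⟨hU, hp⟩
  have h1 : X.presheaf.germ (U ⊓ W) p hUW (X.presheaf.map (Opens.infLELeft U W).op f *
      X.presheaf.map (Opens.infLERight U W).op (idealSection I W e)) =
      X.presheaf.germ (U ⊓ W) p hUW 0 := by
    rw [map_mul, germ_res, germ_res, map_zero, h]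
  obtain ⟨V, hV, j, j', h2⟩ := TopCat.Presheaf.germ_eq X.presheaf p _ _ _ _ h1
  rw [map_zero, map_mul, res_res, res_res] at h2
  have h3 : X.presheaf.map (j ≫ Opens.infLELeft U W).op f •
      (idealModule I).presheaf.map (j ≫ Opens.infLERight U W).op e = 0 := by
    apply idealSection_injective
    rw [idealSection_smul, idealSection_map, map_zero]
    exact h2
  have h4 := congrArg (germHom (idealModule I) _ p hV) h3
  rw [germHom_smul, map_zero, germ_res, germHom_map] at h4
  exact h4

/-! ### Godement sheaves and immersions -/

section

variable (i : Z ⟶ X) {Λ : Type u} {x : Λ → Z} {N N' : Λ → Type u}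
  [∀ l, AddCommGroup (N l)] [∀ l, Module (Z.presheaf.stalk (x l)) (N l)]
  [∀ l, AddCommGroup (N' l)] [∀ l, Module (X.presheaf.stalk (i (x l))) (N' l)]

/-- The morphism from the direct image of a Godement sheaf given by semilinear maps. -/
def pushforwardGodementTo (τ : ∀ l, N l →+ N' l)
    (hτ : ∀ l a n, τ l (i.stalkMap (x l) a • n) = a • τ l n) :
    (Scheme.Modules.pushforward i).obj (godement x N) ⟶ godement (fun l => i (x l)) N' :=
  toGodement (fun l U hl => (τ l).comp (godementEval x N (U := i ⁻¹ᵁ U) l hl))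
    (fun l U hl f s => by
      refine Eq.trans ?_ (hτ l _ _)
      refine congrArg (τ l) ((godementEval_smul x N (U := i ⁻¹ᵁ U) l hl (i.app U f) s).trans ?_)
      exact congrArg (· • _) (germ_app_eq_of_eq rfl U (x l) hl hl f))
    (fun l U V j hl s => rfl)

/-- The morphism to the direct image of a Godement sheaf given by semilinear maps. -/
def toPushforwardGodement (σ : ∀ l, N' l →+ N l)
    (hσ : ∀ l a n, σ l (a • n) = i.stalkMap (x l) a • σ l n) :
    godement (fun l => i (x l)) N' ⟶ (Scheme.Modules.pushforward i).obj (godement x N) :=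
  modulesHomMk (fun U => AddMonoidHom.mk' (fun s => show ∀ l : {l // x l ∈ i ⁻¹ᵁ U}, N l.1 from
        fun l => σ l.1 (godementEval (fun l => i (x l)) N' (U := U) l.1 l.2 s))
      (fun s t => by
        funext l
        change σ l.1 _ = σ l.1 _ + σ l.1 _
        rw [map_add, map_add]))
    (fun U f s => by
      funext l
      change σ l.1 _ = Z.presheaf.germ (i ⁻¹ᵁ U) (x l.1) l.2 (i.app U f) • σ l.1 _
      refine (congrArg (σ l.1) (godementEval_smul (fun l => i (x l)) N' l.1 l.2 f _)).trans
        ((hσ l.1 _ _).trans ?_)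
      exact congrArg (· • _) (germ_app_eq_of_eq rfl U (x l.1) l.2 l.2 f).symm)
    (fun U V j s => rfl)

end

end

section

/-! ### Transversal derivations -/

/-- Derivations on a ring `A` that detect the powers of a generator of the kernel of `π : A →+* R`
in the conormal sequence of `A ⧸ (ker π) ^ m`. -/
structure TransversalData {K A R : Type u} [CommRing K] [CommRing A] [CommRing R] (π : A →+* R)
    (κ : K →+* A) (m : ℕ) where
  z : A
  ker_eq : RingHom.ker π = Ideal.span {z}
  pow_eq_zero : z ^ (m + 1) = 0
  c : A →+ R
  c_mul : ∀ a b, c (a * b) = π a * c b + π b * c a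
  isUnit_c : IsUnit (c z)
  N : Type u
  [addCommGroup : AddCommGroup N]
  [module : Module A N]
  δ : A →+ N
  δ_mul : ∀ a b, δ (a * b) = a • δ b + b • δ a
  δ_const : ∀ r, δ (κ r) = 0
  τ : R →+ N
  τ_smul : ∀ a r, τ (π a * r) = a • τ r
  τ_injective : Function.Injective τ
  -- This makes `N` a module over the stalk of V(I^m), where the Godement sheaf lives.
  smul_eq_zero : ∀ a ∈ RingHom.ker π ^ m, ∀ n : N, a • n = 0
  -- An abstract form of d(z^m) = m z^{m-1} dz. It is required for all of the kernel, not only for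
  -- `z`: a section equal to the chosen generator at one point need not be so at nearby points.
  δ_pow : ∀ a, π a = 0 → δ (a ^ m) = τ (c a ^ m)

attribute [instance] TransversalData.addCommGroup TransversalData.module

/-- The module structure over a quotient of a ring that is induced by a module over the ring. -/
@[reducible]
def moduleOfSurjective {A B N : Type*} [CommRing A] [CommRing B] [AddCommGroup N] [Module A N]
    (f : A →+* B) (hf : Function.Surjective f) (h : ∀ a, f a = 0 → ∀ n : N, a • n = 0) :
    Module B N :=
  Module.compHom N (f.liftOfSurjective hf ⟨Module.toAddMonoidEnd A N, fun a ha => by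
    ext n
    exact h a ha n⟩)

lemma moduleOfSurjective_smul {A B N : Type*} [CommRing A] [CommRing B] [AddCommGroup N]
    [Module A N] (f : A →+* B) (hf : Function.Surjective f) (h : ∀ a, f a = 0 → ∀ n : N, a • n = 0)
    (a : A) (n : N) :
    letI := moduleOfSurjective f hf h
    f a • n = a • n :=
  DFunLike.congr_fun (f.liftOfRightInverse_comp_apply _ (Function.rightInverse_surjInv hf)
    ⟨Module.toAddMonoidEnd A N, fun a ha => by
    ext n
    exact h a ha n⟩ a) n

variable {R : CommRingCat.{u}} {X : Scheme.{u}}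

section

variable (I : X.IdealSheafData) (a : X ⟶ Spec R) {m : ℕ} {Λ : Type u}

/-- The closed immersion `V(I) ⟶ V(I ^ m)`. -/
abbrev powInclusion (hm : m ≠ 0) : I.subscheme ⟶ (I ^ m).subscheme :=
  Scheme.IdealSheafData.inclusion (pow_le_self I hm)

lemma subschemeι_eq_powInclusion (hm : m ≠ 0) :
    I.subschemeι = powInclusion I hm ≫ (I ^ m).subschemeι := by simp

variable (x : Λ → (I ^ m).subscheme) {N : Λ → Type u} [∀ l, AddCommGroup (N l)]
  [∀ l, Module (X.presheaf.stalk ((I ^ m).subschemeι (x l))) (N l)]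
  [∀ l, Module ((I ^ m).subscheme.presheaf.stalk (x l)) (N l)]
  (hN : ∀ l (r : X.presheaf.stalk ((I ^ m).subschemeι (x l))) (n : N l),
    (I ^ m).subschemeι.stalkMap (x l) r • n = r • n)
  (δ : ∀ l, X.presheaf.stalk ((I ^ m).subschemeι (x l)) →+ N l)
  (δ_mul : ∀ l r s, δ l (r * s) = r • δ l s + s • δ l r)
  (δ_const : ∀ l r, δ l (stalkConst a ((I ^ m).subschemeι (x l)) r) = 0)

/-- The morphism from the restriction of `Ω_X` to a closed subscheme to a Godement sheaf given by
derivations of stalks. -/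
def omegaPullbackToGodement :
    (Scheme.Modules.pullback (I ^ m).subschemeι).obj (omega a) ⟶ godement x N :=
  pullbackDesc (omegaToGodement a δ δ_mul δ_const ≫
    toPushforwardGodement (I ^ m).subschemeι (fun l => AddMonoidHom.id (N l))
      (fun l r n => (hN l r n).symm))

lemma godementComponent_conormalToOmega (l : Λ) {U : X.Opens}
    (hl : x l ∈ (I ^ m).subschemeι ⁻¹ᵁ U) (hl' : (I ^ m).subschemeι (x l) ∈ U)
    (s : Γ(idealModule (I ^ m), U)) :
    godementComponent (conormalToOmega (I ^ m) a ≫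
        omegaPullbackToGodement I a x hN δ δ_mul δ_const) l _ hl
      (pullbackSection (I ^ m).subschemeι _ U s) =
      δ l (X.presheaf.germ U ((I ^ m).subschemeι (x l)) hl' (idealSection (I ^ m) U s)) := by
  refine (congrArg (fun t => godementEval x N l hl
    ((omegaPullbackToGodement I a x hN δ δ_mul δ_const).app _ t))
    (conormalToOmega_apply (I ^ m) a U s)).trans ?_
  refine (congrArg (godementEval x N l hl) (pullbackDesc_pullbackSection _ U _)).trans ?_
  exact godementEval_omegaToGodement a δ δ_mul δ_const U l hl' _

end

section

variable (I : X.IdealSheafData) {C : Scheme.{u}} (r : I.subscheme ⟶ C) (i : C ⟶ X)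
  (hri : I.subschemeι = r ≫ i) {Λ : Type u} (x : Λ → I.subscheme)
  (c : ∀ l, X.presheaf.stalk ((r ≫ i) (x l)) →+ I.subscheme.presheaf.stalk (x l))
  (hc : ∀ l a b, c l (a * b) =
    (r ≫ i).stalkMap (x l) a * c l b + (r ≫ i).stalkMap (x l) b * c l a)
  {N : Λ → Type u} [∀ l, AddCommGroup (N l)] [∀ l, Module (C.presheaf.stalk (r (x l))) (N l)]
  (τ : ∀ l, I.subscheme.presheaf.stalk (x l) →+ N l)
  (hτ : ∀ l b n, τ l (r.stalkMap (x l) b • n) = b • τ l n) (m : ℕ)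

/-- The morphism from a power of the conormal sheaf to a Godement sheaf. -/
def conormalPowToGodement :
    (Scheme.Modules.pushforward r).obj (tensorPow (conormal I) m) ⟶
      godement (fun l => r (x l)) N :=
  (Scheme.Modules.pushforward r).map
    (tensorPowToGodement (conormalToGodement I hri x c hc) m) ≫ pushforwardGodementTo r τ hτ

lemma godementComponent_conormalPowToGodement (l : Λ) {U : C.Opens} {V : X.Opens}
    (hl : r (x l) ∈ U) (hl' : (r ≫ i) (x l) ∈ V) (j : r ⁻¹ᵁ U ⟶ I.subschemeι ⁻¹ᵁ V)
    (s : Γ(idealModule I, V)) :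
    godementComponent (conormalPowToGodement I r i hri x c hc τ hτ m) l U hl
      (tensorPowSection (U := r ⁻¹ᵁ U)
        ((conormal I).presheaf.map j.op (conormalSection I V s)) m) =
      τ l (c l (X.presheaf.germ V ((r ≫ i) (x l)) hl' (idealSection I V s)) ^ m) := by
  have hl₁ : x l ∈ r ⁻¹ᵁ U := hl
  refine congrArg (τ l) ((godementComponent_tensorPowToGodement _ l (r ⁻¹ᵁ U) hl₁ _ m).trans ?_)
  congr 1
  refine (godementComponent_map _ l j hl₁ _).trans ?_
  exact godementComponent_conormalToGodement I hri x c hc l V _ s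

end

end

/-! ### Comparison of I^m with the m-th power of the conormal sheaf. -/

section

variable {R : CommRingCat.{u}} {X Z : Scheme.{u}}

section

variable (I : X.IdealSheafData) {g : I.subscheme ⟶ X} (hg : I.subschemeι = g)

include hg in
lemma generatesAt_idealModule_of_ker_eq {p : I.subscheme} {z : X.presheaf.stalk (g p)}
    (hz : RingHom.ker (g.stalkMap p).hom = Ideal.span {z}) {U : X.Opens} (hp : g p ∈ U)
    (s : Γ(idealModule I, U)) (hs : X.presheaf.germ U (g p) hp (idealSection I U s) = z) :
    GeneratesAt (idealModule I) s (g p) := by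
  refine generatesAt_idealModule I s hp fun V hV t => ?_
  rw [hs, ← Ideal.mem_span_singleton, ← hz]
  have hV' : p ∈ I.subschemeι ⁻¹ᵁ V := by rw [hg]; exact hV
  exact stalkMap_germ_idealSection I hg hV' hV t

include hg in
lemma generatesAt_idealModule_pow_of_ker_eq {p : I.subscheme} {z : X.presheaf.stalk (g p)}
    (hz : RingHom.ker (g.stalkMap p).hom = Ideal.span {z}) {k : ℕ} {U : X.Opens} (hp : g p ∈ U)
    (s : Γ(idealModule (I ^ k), U))
    (hs : X.presheaf.germ U (g p) hp (idealSection (I ^ k) U s) = z ^ k) :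
    GeneratesAt (idealModule (I ^ k)) s (g p) := by
  refine generatesAt_idealModule (I ^ k) s hp fun V hV t => ?_
  rw [hs, ← Ideal.mem_span_singleton, ← Ideal.span_singleton_pow, ← hz]
  exact germ_mem_ker_pow I hg k p hV _ (subschemeι_app_idealSection _ _ _)

end

lemma mem_ker_pow_of_stalkMap_eq_zero (I : X.IdealSheafData) {k : ℕ}
    (r : I.subscheme ⟶ (I ^ k).subscheme) (hg : I.subschemeι = r ≫ (I ^ k).subschemeι)
    (p : I.subscheme) {b : X.presheaf.stalk ((r ≫ (I ^ k).subschemeι) p)}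
    (hb : (I ^ k).subschemeι.stalkMap (r p) b = 0) :
    b ∈ RingHom.ker ((r ≫ (I ^ k).subschemeι).stalkMap p).hom ^ k := by
  obtain ⟨U, hU, f, hf, e⟩ := exists_mem_ideal (I ^ k) rfl (r p) hb
  have h : (I ^ k).subschemeι.app U.1 f = 0 := by
    rw [← (I ^ k).ker_subschemeι_app] at hf
    exact hf
  have h1 := germ_mem_ker_pow I hg k p hU f h
  rw [← e]
  exact h1

lemma generatesAt_tensorPowSection_conormalSection (I : X.IdealSheafData) {C : Scheme.{u}}
    (r : I.subscheme ⟶ C) (i : C ⟶ X) (hri : I.subschemeι = r ≫ i) [IsPreimmersion r] (m : ℕ)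
    {p : I.subscheme} {U : C.Opens} {V : X.Opens} (hp : r p ∈ U) (hp' : (r ≫ i) p ∈ V)
    (j : r ⁻¹ᵁ U ⟶ I.subschemeι ⁻¹ᵁ V) {s : Γ(idealModule I, V)} {z : X.presheaf.stalk ((r ≫ i) p)}
    (hz : RingHom.ker ((r ≫ i).stalkMap p).hom = Ideal.span {z})
    (hs : X.presheaf.germ V _ hp' (idealSection I V s) = z) :
    GeneratesAt ((Scheme.Modules.pushforward r).obj (tensorPow (conormal I) m)) (W := U)
      (tensorPowSection (U := r ⁻¹ᵁ U)
        ((conormal I).presheaf.map j.op (conormalSection I V s)) m) (r p) := by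
  have h1 := generatesAt_idealModule_of_ker_eq I hri hz hp' s hs
  have e : (r ≫ i) p = I.subschemeι p := by rw [hri]
  rw [e] at h1
  have hp₁ : p ∈ r ⁻¹ᵁ U := hp
  exact (((generatesAt_conormalSection I (j.le hp₁) h1).res j hp₁).tensorPowSection
    hp₁ m).pushforward r hp₁

lemma stalkMap_stalkMap_apply {C : Scheme.{u}} {p : C} (r : C ⟶ Z) (i : Z ⟶ X)
    (b : X.presheaf.stalk ((r ≫ i) p)) :
    r.stalkMap p (i.stalkMap (r p) b) = (r ≫ i).stalkMap p b :=
  (ConcreteCategory.congr_hom (Scheme.Hom.stalkMap_comp r i p) b).symm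

section

variable (I : X.IdealSheafData) (a : X ⟶ Spec R) {m : ℕ} (r : I.subscheme ⟶ Z) (i : Z ⟶ X)
  [IsPreimmersion r] [IsPreimmersion i] (hg : I.subschemeι = r ≫ i) {Λ : Type u}
  (x : Λ → I.subscheme)
  (E : ∀ l, TransversalData ((r ≫ i).stalkMap (x l)).hom (stalkConst a ((r ≫ i) (x l))) m)

instance TransversalData.moduleStalk (l : Λ) : Module (X.presheaf.stalk (i (r (x l)))) (E l).N :=
  (E l).module

omit [IsPreimmersion r] in
lemma exists_module_transversalData (h : ∀ l (b : X.presheaf.stalk ((r ≫ i) (x l))),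
      i.stalkMap (r (x l)) b = 0 → b ∈ RingHom.ker ((r ≫ i).stalkMap (x l)).hom ^ m) :
    ∃ _ : ∀ l, Module (Z.presheaf.stalk (r (x l))) (E l).N,
      ∀ l (b : X.presheaf.stalk (i (r (x l)))) (n : (E l).N),
        i.stalkMap (r (x l)) b • n = b • n :=
  ⟨fun l => moduleOfSurjective (A := X.presheaf.stalk ((r ≫ i) (x l)))
    (i.stalkMap (r (x l))).hom (i.stalkMap_surjective (r (x l)))
    (fun b hb n => (E l).smul_eq_zero b (h l b hb) n),
   fun l b n => moduleOfSurjective_smul (A := X.presheaf.stalk ((r ≫ i) (x l))) _ _ _ b n⟩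

variable [∀ l, Module (Z.presheaf.stalk (r (x l))) (E l).N]
  (hN : ∀ l (b : X.presheaf.stalk (i (r (x l)))) (n : (E l).N), i.stalkMap (r (x l)) b • n = b • n)

include hN

omit [IsPreimmersion r] in
lemma TransversalData.τ_stalkMap_smul (l : Λ) (b : Z.presheaf.stalk (r (x l)))
    (n : I.subscheme.presheaf.stalk (x l)) :
    (E l).τ (r.stalkMap (x l) b • n) = b • (E l).τ n := by
  obtain ⟨b, rfl⟩ := i.stalkMap_surjective (r (x l)) b
  refine Eq.trans ?_ (((E l).τ_smul b n).trans (hN l b _).symm)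
  exact congrArg (fun k => (E l).τ (k * n)) (stalkMap_stalkMap_apply r i b)

omit [IsPreimmersion r] [IsPreimmersion i] in
-- As `τ` is injective and `c z` is a unit, annihilating the common image forces `b` into the
-- kernel, which is generated by `z`; then `b * z ^ m` vanishes because `z ^ (m + 1)` does. So the
-- annihilator of the image kills both generators.
lemma TransversalData.mul_pow_eq_zero {l : Λ} {b : X.presheaf.stalk ((r ≫ i) (x l))}
    (h : i.stalkMap (r (x l)) b • (E l).τ ((E l).c (E l).z ^ m) = 0) :
    (r ≫ i).stalkMap (x l) b = 0 ∧ b * (E l).z ^ m = 0 := by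
  have h1 : (E l).τ ((r ≫ i).stalkMap (x l) b * (E l).c (E l).z ^ m) = 0 :=
    ((E l).τ_smul _ _).trans ((hN l b _).symm.trans h)
  rw [map_eq_zero_iff _ (E l).τ_injective, ((E l).isUnit_c.pow m).mul_left_eq_zero] at h1
  refine ⟨h1, ?_⟩
  obtain ⟨w, rfl⟩ := Ideal.mem_span_singleton.1 ((E l).ker_eq.le h1)
  rw [mul_right_comm, ← pow_succ', (E l).pow_eq_zero, zero_mul]

include hg

/-- The comparison of generators, with `P` in the role of I^m and `t` in that of z^m. The last
condition says that `t` and the tensor power of `s` have the same image at every chosen point of the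
neighbourhood, hence define the same section of the Godement sheaf. -/
lemma mono_and_nonempty_iso_of_transversalData [JacobsonSpace Z]
    (hx : ∀ q : Z, IsClosed {q} → ∃ l, r (x l) = q) (P : X.Modules)
    (F : (Scheme.Modules.pullback i).obj P ⟶ godement (fun l => r (x l)) (fun l => (E l).N))
    (H : ∀ l, ∃ (U : X.Opens) (hU : (r ≫ i) (x l) ∈ U) (s : Γ(idealModule I, U)) (t : Γ(P, U)),
      X.presheaf.germ U _ hU (idealSection I U s) = (E l).z ∧
      GeneratesAt P t ((r ≫ i) (x l)) ∧
      (∀ b : X.presheaf.stalk ((r ≫ i) (x l)), b * (E l).z ^ m = 0 →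
        b • germHom P U _ hU t = 0) ∧
      ∀ l' (hl : r (x l') ∈ i ⁻¹ᵁ U) (hl' : (r ≫ i) (x l') ∈ U),
        godementComponent F l' _ hl (pullbackSection i P U t) =
          (E l').τ ((E l').c (X.presheaf.germ U _ hl' (idealSection I U s)) ^ m)) :
    Mono F ∧ Nonempty ((Scheme.Modules.pullback i).obj P ≅
      (Scheme.Modules.pushforward r).obj (tensorPow (conormal I) m)) := by
  have key := mono_and_nonempty_iso_of_generatesAt (x := fun l => r (x l)) hx
    F (conormalPowToGodement I r i hg x (fun l => (E l).c) (fun l => (E l).c_mul)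
    (fun l => (E l).τ) (TransversalData.τ_stalkMap_smul I a r i x E hN) m) ?_
  · exact ⟨key.1, key.2.2⟩
  intro l
  obtain ⟨U, hU, s, t, hs, hgen, hann, hF⟩ := H l
  have hU' : r (x l) ∈ i ⁻¹ᵁ U := hU
  let j : r ⁻¹ᵁ i ⁻¹ᵁ U ⟶ I.subschemeι ⁻¹ᵁ U := eqToHom (by rw [hg]; rfl)
  refine ⟨i ⁻¹ᵁ U, hU', pullbackSection i P U t, tensorPowSection (U := r ⁻¹ᵁ i ⁻¹ᵁ U)
      ((conormal I).presheaf.map j.op (conormalSection I U s)) m, ?_, ?_, ?_, ?_⟩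
  · exact hgen.pullback i hU'
  · exact generatesAt_tensorPowSection_conormalSection I r i hg m hU' hU j (E l).ker_eq hs
  · exact godement_ext fun l' hl' => (hF l' hl' hl').trans
      (godementComponent_conormalPowToGodement I r i hg x (fun l => (E l).c)
        (fun l => (E l).c_mul) (fun l => (E l).τ) (TransversalData.τ_stalkMap_smul I a r i x E hN)
        m l' hl' hl' j s).symm
  · intro b hb
    obtain ⟨b, rfl⟩ := i.stalkMap_surjective (r (x l)) b
    rw [hF l hU' hU, hs] at hb
    have h1 := TransversalData.mul_pow_eq_zero I a r i x E hN hb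
    exact ⟨stalkMap_smul_germHom_pullbackSection_eq_zero i hU' hU (hann b h1.2),
      smul_germHom_pushforward_eq_zero r hU' _ ((stalkMap_stalkMap_apply r i b).trans h1.1)⟩

end

section

variable (I : X.IdealSheafData) (a : X ⟶ Spec R) {m : ℕ} (r : I.subscheme ⟶ (I ^ m).subscheme)
  (hg : I.subschemeι = r ≫ (I ^ m).subschemeι) {Λ : Type u}
  (x : Λ → I.subscheme)
  (E : ∀ l, TransversalData ((r ≫ (I ^ m).subschemeι).stalkMap (x l)).hom
    (stalkConst a ((r ≫ (I ^ m).subschemeι) (x l))) m)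

include hg

lemma exists_sections_transversal (l : Λ) : ∃ (U : X.Opens)
    (hl : (r ≫ (I ^ m).subschemeι) (x l) ∈ U) (s : Γ(idealModule I, U))
    (t : Γ(idealModule (I ^ m), U)), X.presheaf.germ U _ hl (idealSection I U s) = (E l).z ∧
      idealSection (I ^ m) U t = idealSection I U s ^ m := by
  have hz : (r ≫ (I ^ m).subschemeι).stalkMap (x l) (E l).z = 0 := by
    change (E l).z ∈ RingHom.ker ((r ≫ (I ^ m).subschemeι).stalkMap (x l)).hom
    rw [(E l).ker_eq]
    exact Ideal.mem_span_singleton_self _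
  obtain ⟨U, hU, f, hf, hfz⟩ := exists_mem_ideal I hg (x l) hz
  obtain ⟨s, hs⟩ := exists_idealSection I U.1 f (by
    rw [← I.ker_subschemeι_app] at hf
    exact hf)
  obtain ⟨t, ht⟩ := exists_idealSection (I ^ m) U.1 (f ^ m) (subschemeι_pow_app_eq_zero I m hf)
  exact ⟨U, hU, s, t, by rw [hs, hfz], by rw [ht, hs]⟩

include E in
lemma mono_conormalToOmega_of_transversalData [IsPreimmersion r]
    [JacobsonSpace (I ^ m).subscheme]
    (hx : ∀ q : (I ^ m).subscheme, IsClosed {q} → ∃ l, r (x l) = q) :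
    Mono (conormalToOmega (I ^ m) a) ∧
    Nonempty ((Scheme.Modules.pullback (I ^ m).subschemeι).obj (idealModule (I ^ m)) ≅
      (Scheme.Modules.pushforward r).obj (tensorPow (conormal I) m)) := by
  obtain ⟨inst, hN⟩ := exists_module_transversalData I a r (I ^ m).subschemeι x E
    (fun l b hb => mem_ker_pow_of_stalkMap_eq_zero I r hg (x l) hb)
  have key := mono_and_nonempty_iso_of_transversalData I a r (I ^ m).subschemeι hg x E hN hx
    (idealModule (I ^ m)) (conormalToOmega (I ^ m) a ≫ omegaPullbackToGodement I a
      (fun l => r (x l)) hN (fun l => (E l).δ) (fun l => (E l).δ_mul) (fun l => (E l).δ_const)) ?_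
  · have h1 := key.1
    exact ⟨@mono_of_mono _ _ _ _ _ _ _ h1, key.2⟩
  intro l
  obtain ⟨U, hU, s, t, hs, ht⟩ := exists_sections_transversal I a r hg x E l
  refine ⟨U, hU, s, t, hs, ?_, ?_, ?_⟩
  · exact generatesAt_idealModule_pow_of_ker_eq I hg (E l).ker_eq hU t (by rw [ht, map_pow, hs])
  · intro b hb
    refine smul_germHom_idealModule_eq_zero (I ^ m) hU ?_
    rw [ht, map_pow, hs, hb]
  · intro l' hl hl'
    refine (godementComponent_conormalToOmega I a (fun l => r (x l)) hN
      (fun l => (E l).δ) (fun l => (E l).δ_mul) (fun l => (E l).δ_const) l' hl hl' t).trans ?_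
    rw [ht, map_pow]
    exact (E l').δ_pow _ (stalkMap_germ_idealSection I hg (by rw [hg]; exact hl') hl' s)

end

lemma exists_eq_of_isClosed {C : Scheme.{u}} {g : C ⟶ X} (r : C ⟶ Z) (i : Z ⟶ X)
    [IsClosedImmersion i] (hg : g = r ≫ i) (hsurj : Function.Surjective g) {q : Z}
    (hq : IsClosed {q}) : ∃ p : C, IsClosed {g p} ∧ r p = q := by
  obtain ⟨p, hp⟩ := hsurj (i q)
  refine ⟨p, ?_, ?_⟩
  · rw [hp, ← Set.image_singleton]
    exact i.isClosedEmbedding.isClosedMap _ hq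
  · apply i.isClosedEmbedding.injective
    rw [← hp, hg]
    rfl

lemma nonempty_transversalData_of_eq {C : Scheme.{u}} {f g : C ⟶ X} (h : f = g) (a : X ⟶ Spec R)
    {m : ℕ} {p : C} (D : Nonempty (TransversalData (f.stalkMap p).hom (stalkConst a (f p)) m)) :
    Nonempty (TransversalData (g.stalkMap p).hom (stalkConst a (g p)) m) := by
  subst h; exact D

theorem mono_conormalToOmega_and_nonempty_iso (I : X.IdealSheafData) (a : X ⟶ Spec R) {m : ℕ}
    (r : I.subscheme ⟶ (I ^ m).subscheme) (hg : I.subschemeι = r ≫ (I ^ m).subschemeι)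
    [JacobsonSpace (I ^ m).subscheme] (hI : Function.Surjective I.subschemeι)
    (D : ∀ p : I.subscheme, IsClosed {I.subschemeι p} → Nonempty
      (TransversalData (I.subschemeι.stalkMap p).hom (stalkConst a (I.subschemeι p)) m)) :
    Mono (conormalToOmega (I ^ m) a) ∧
    Nonempty ((Scheme.Modules.pullback (I ^ m).subschemeι).obj (idealModule (I ^ m)) ≅
      (Scheme.Modules.pushforward r).obj (tensorPow (conormal I) m)) := by
  have : IsPreimmersion r := by
    have : IsPreimmersion (r ≫ (I ^ m).subschemeι) := hg ▸ inferInstance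
    exact IsPreimmersion.of_comp r (I ^ m).subschemeι
  -- The data are chosen separately at each closed point, and nothing relates the choices at
  -- different points.
  let E (l : {p : I.subscheme // IsClosed {I.subschemeι p}}) :=
    (nonempty_transversalData_of_eq hg a (D l.1 l.2)).some
  refine mono_conormalToOmega_of_transversalData I a r hg Subtype.val E (fun q hq => ?_)
  obtain ⟨p, hp, hpq⟩ := exists_eq_of_isClosed r _ hg hI hq
  exact ⟨⟨p, hp⟩, hpq⟩

end

section

/-! ### Existence of transversal derivations -/

open TensorProduct in
/-- If `B` is a ring with free differentials of rank `2`, and `R = B / z` is a local ring whose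
differentials are generated by one element, then `z` has a partial derivative that is a unit. -/
lemma exists_derivation_isUnit (k : Type*) {B R : Type*} [CommRing k] [CommRing B] [CommRing R]
    [IsLocalRing R] [Algebra k B] [Algebra k R] [Algebra B R] [IsScalarTower k B R]
    (hsurj : Function.Surjective (algebraMap B R)) {z : B}
    (hz : RingHom.ker (algebraMap B R) = Ideal.span {z}) (e : Module.Basis (Fin 2) B Ω[B⁄k])
    {w : Ω[R⁄k]} (hw : Submodule.span R {w} = ⊤) : ∃ D : Derivation k B R, IsUnit (D z) := by
  let e' : Module.Basis (Fin 2) R (R ⊗[B] Ω[B⁄k]) := e.baseChange R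
  let π := KaehlerDifferential.mapBaseChange k B R
  have hπ : Function.Surjective π := KaehlerDifferential.mapBaseChange_surjective k B R hsurj
  -- By the conormal sequence an element of the kernel of `π` is the class of some d(bz), which
  -- equals b dz over `R`. If one of its coordinates is a unit, so is that coordinate of dz, and the
  -- coordinate function gives the derivation.
  suffices h : ∃ t, π t = 0 ∧ ∃ i, IsUnit (e'.repr t i) by
    obtain ⟨t, ht, i, hi⟩ := h
    obtain ⟨x, rfl⟩ :=
      (KaehlerDifferential.exact_kerCotangentToTensor_mapBaseChange k B R hsurj t).1 ht
    obtain ⟨⟨y, hy⟩, rfl⟩ := Ideal.toCotangent_surjective _ x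
    have hy' := hy
    rw [hz, Ideal.mem_span_singleton'] at hy'
    obtain ⟨b, rfl⟩ := hy'
    have hz0 : algebraMap B R z = 0 := by
      rw [← RingHom.mem_ker, hz]
      exact Ideal.mem_span_singleton_self z
    let f : Ω[B⁄k] →ₗ[B] R := ((e'.coord i).restrictScalars B).comp (TensorProduct.mk B R Ω[B⁄k] 1)
    refine ⟨f.compDer (KaehlerDifferential.D k B), ?_⟩
    have h1 : e'.repr (KaehlerDifferential.kerCotangentToTensor k B R
        (Ideal.toCotangent _ ⟨b * z, hy⟩)) i = f (KaehlerDifferential.D k B (b * z)) := by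
      rw [KaehlerDifferential.kerCotangentToTensor_toCotangent]
      rfl
    rw [h1, Derivation.leibniz, map_add, map_smul, map_smul, Algebra.smul_def, Algebra.smul_def,
      hz0, zero_mul, add_zero] at hi
    exact isUnit_of_mul_isUnit_right hi
  have hr (i : Fin 2) : ∃ r : R, r • w = π (e' i) := by
    rw [← Submodule.mem_span_singleton, hw]
    trivial
  choose r hr using hr
  -- If `r i` is a unit, it can be used to eliminate `w`, leaving a kernel element with coordinate 1
  -- at `j`.
  have key (i j : Fin 2) (hij : i ≠ j) (h : IsUnit (r i)) :
      ∃ t, π t = 0 ∧ ∃ i, IsUnit (e'.repr t i) := by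
    obtain ⟨s, hs⟩ := h.exists_left_inv
    refine ⟨e' j - (r j * s) • e' i, ?_, j, ?_⟩
    · rw [map_sub, map_smul, ← hr, ← hr, smul_smul, mul_assoc, hs, mul_one, sub_self]
    · simp [hij]
  by_cases h0 : IsUnit (r 0)
  · exact key 0 1 (by simp) h0
  by_cases h1 : IsUnit (r 1)
  · exact key 1 0 (by simp) h1
  obtain ⟨t, ht⟩ := hπ w
  -- If neither `r i` is a unit, then `w` is a multiple of itself by an element of the maximal
  -- ideal, so it vanishes and every basis vector lies in the kernel.
  have hw0 : w = 0 := by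
    have h2 : (e'.repr t 0 * r 0 + e'.repr t 1 * r 1) • w = w := by
      conv_rhs => rw [← ht, ← e'.sum_repr t]
      simp only [Fin.sum_univ_two, map_add, map_smul, ← hr, smul_smul, add_smul]
    have h3 : IsUnit (1 - (e'.repr t 0 * r 0 + e'.repr t 1 * r 1)) := by
      have h4 : e'.repr t 0 * r 0 + e'.repr t 1 * r 1 ∈ IsLocalRing.maximalIdeal R :=
        Ideal.add_mem _ (Ideal.mul_mem_left _ _ h0) (Ideal.mul_mem_left _ _ h1)
      by_contra h5
      have h6 := Ideal.add_mem _ ((IsLocalRing.mem_maximalIdeal _).2 h5) h4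
      rw [sub_add_cancel] at h6
      exact (IsLocalRing.mem_maximalIdeal _).1 h6 isUnit_one
    rw [← h3.smul_eq_zero, sub_smul, one_smul, h2, sub_self]
  refine ⟨e' 0, by rw [← hr, hw0, smul_zero], 0, by simp⟩

/-! ### Dual numbers and truncated polynomials. -/

open Polynomial

/-- The homomorphism to the ring of dual numbers given by a derivation. -/
def dualNumberHom {k B R : Type*} [CommRing k] [CommRing B] [CommRing R]
    [Algebra k B] [Algebra k R] [Algebra B R] [IsScalarTower k B R] (D : Derivation k B R) :
    B →ₐ[k] DualNumber R where
  toFun b := TrivSqZeroExt.inl (algebraMap B R b) + TrivSqZeroExt.inr (D b)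
  map_one' := by simp
  map_mul' a b := by
    ext
    · simp
    · simp [Algebra.smul_def, mul_comm, TrivSqZeroExt.algebraMap_eq_inl]
  map_zero' := by simp
  map_add' a b := by
    ext <;> simp
  commutes' r := by
    ext
    · simp [← IsScalarTower.algebraMap_apply, TrivSqZeroExt.algebraMap_eq_inl']
    · simp [TrivSqZeroExt.algebraMap_eq_inl']

variable (R : Type*) [CommRing R]

/-- The ring of truncated polynomials. -/
abbrev Truncated (n : ℕ) : Type _ := R[X] ⧸ Ideal.span {(X : R[X]) ^ n}

variable {R}

lemma aeval_eps (P : R[X]) : aeval (DualNumber.eps : DualNumber R) P =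
    TrivSqZeroExt.inl (P.coeff 0) + TrivSqZeroExt.inr (P.coeff 1) := by
  induction P using Polynomial.induction_on' with
  | add p q hp hq =>
    rw [map_add, hp, hq]
    ext <;> simp
  | monomial n a =>
    rw [aeval_monomial, TrivSqZeroExt.algebraMap_eq_inl]
    match n with
    | 0 => ext <;> simp
    | 1 => ext <;> simp [coeff_monomial]
    | n + 2 =>
      rw [pow_add, pow_two, DualNumber.eps_mul_eps]
      ext <;> simp [coeff_monomial]

/-- The truncation of a truncated polynomial to a dual number. -/
def truncatedToDual {n : ℕ} (hn : 2 ≤ n) : Truncated R n →ₐ[R] DualNumber R :=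
  Ideal.Quotient.liftₐ _ (aeval DualNumber.eps) (fun P hP => by
    obtain ⟨Q, rfl⟩ := Ideal.mem_span_singleton.1 hP
    obtain ⟨l, rfl⟩ := Nat.exists_eq_add_of_le hn
    rw [map_mul, map_pow, aeval_X, pow_add, pow_two, DualNumber.eps_mul_eps, zero_mul, zero_mul])

lemma truncatedToDual_mk {n : ℕ} (hn : 2 ≤ n) (P : R[X]) :
    truncatedToDual hn (Ideal.Quotient.mk _ P) =
      TrivSqZeroExt.inl (P.coeff 0) + TrivSqZeroExt.inr (P.coeff 1) := aeval_eps P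

lemma truncatedToDual_surjective {n : ℕ} (hn : 2 ≤ n) :
    Function.Surjective (truncatedToDual (R := R) hn) := by
  intro y
  refine ⟨Ideal.Quotient.mk _ (C y.fst + C y.snd * X), ?_⟩
  rw [truncatedToDual_mk]
  ext <;> simp

/-- The kernel lies in the ideal generated by X, whose `n`-th power is zero. Nilpotence is what
allows lifting by formal smoothness. -/
lemma isNilpotent_ker_truncatedToDual {n : ℕ} (hn : 2 ≤ n) :
    IsNilpotent (RingHom.ker (truncatedToDual (R := R) hn)) := by
  refine ⟨n, ?_⟩
  have h : RingHom.ker (truncatedToDual (R := R) hn) ≤ Ideal.span {Ideal.Quotient.mk _ X} := by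
    intro y hy
    obtain ⟨P, rfl⟩ := Ideal.Quotient.mk_surjective y
    rw [RingHom.mem_ker, truncatedToDual_mk] at hy
    have h0 : P.coeff 0 = 0 := by simpa using congrArg TrivSqZeroExt.fst hy
    obtain ⟨Q, rfl⟩ := X_dvd_iff.2 h0
    rw [map_mul, Ideal.mem_span_singleton]
    exact dvd_mul_right _ _
  refine eq_bot_iff.2 ((Ideal.pow_right_mono h n).trans ?_)
  rw [Ideal.span_singleton_pow, ← map_pow, Ideal.span_singleton_le_iff_mem, Ideal.mem_bot,
    Ideal.Quotient.eq_zero_iff_mem]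
  exact Ideal.mem_span_singleton_self _

/-- The derivative of a truncated polynomial. -/
def truncatedDerivative (m : ℕ) : Truncated R (m + 1) →+ Truncated R m :=
  QuotientAddGroup.lift (Ideal.span {(X : R[X]) ^ (m + 1)}).toAddSubgroup
    ((Ideal.Quotient.mk (Ideal.span {(X : R[X]) ^ m})).toAddMonoidHom.comp
      (derivative (R := R)).toAddMonoidHom) (fun P hP => by
    obtain ⟨Q, rfl⟩ := Ideal.mem_span_singleton.1 hP
    change Ideal.Quotient.mk _ (derivative (X ^ (m + 1) * Q)) = 0
    -- Differentiating a multiple of X^(m+1) gives only a multiple of X^m, hence the drop in the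
    -- order of truncation.
    rw [Ideal.Quotient.eq_zero_iff_dvd, derivative_mul, derivative_X_pow]
    refine dvd_add (dvd_mul_of_dvd_left ?_ _) (dvd_mul_of_dvd_left (pow_dvd_pow _ m.le_succ) _)
    exact dvd_mul_left _ _)

lemma truncatedDerivative_mk (m : ℕ) (P : R[X]) :
    truncatedDerivative m (Ideal.Quotient.mk _ P) = Ideal.Quotient.mk _ (derivative P) := rfl

/-- The truncation of a truncated polynomial. -/
def truncate (m : ℕ) : Truncated R (m + 1) →+* Truncated R m :=
  Ideal.Quotient.factor (Ideal.span_singleton_le_span_singleton.2 (pow_dvd_pow _ m.le_succ))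

lemma truncate_mk (m : ℕ) (P : R[X]) :
    truncate m (Ideal.Quotient.mk _ P) = Ideal.Quotient.mk _ P := rfl

lemma truncatedDerivative_mul (m : ℕ) (p q : Truncated R (m + 1)) :
    truncatedDerivative m (p * q) =
      truncate m p * truncatedDerivative m q + truncate m q * truncatedDerivative m p := by
  obtain ⟨P, rfl⟩ := Ideal.Quotient.mk_surjective p
  obtain ⟨Q, rfl⟩ := Ideal.Quotient.mk_surjective q
  rw [← map_mul, truncatedDerivative_mk, truncatedDerivative_mk, truncatedDerivative_mk,
    truncate_mk, truncate_mk, ← map_mul, ← map_mul, ← map_add, derivative_mul]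
  congr 1
  ring

/-- The map `r ↦ m r X ^ (m - 1)`. -/
def truncatedTop (m : ℕ) : R →+ Truncated R m :=
  (Ideal.Quotient.mk (Ideal.span {(X : R[X]) ^ m})).toAddMonoidHom.comp
    ((AddMonoidHom.mulRight ((m : R[X]) * X ^ (m - 1))).comp (C (R := R)).toAddMonoidHom)

lemma truncatedTop_apply (m : ℕ) (r : R) :
    truncatedTop m r = Ideal.Quotient.mk _ (C r * ((m : R[X]) * X ^ (m - 1))) := rfl

/-- The coefficient of X^(m-1) in the image of `r` is m r. Invertibility of `m` is where
characteristic zero enters. -/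
lemma truncatedTop_injective {m : ℕ} (hm : IsUnit (m : R)) (hm' : m ≠ 0) :
    Function.Injective (truncatedTop (R := R) m) := by
  rw [injective_iff_map_eq_zero]
  intro r hr
  rw [truncatedTop_apply, Ideal.Quotient.eq_zero_iff_dvd, X_pow_dvd_iff] at hr
  have h := hr (m - 1) (by omega)
  rw [coeff_C_mul, ← C_eq_natCast, coeff_C_mul, coeff_X_pow, if_pos rfl, mul_one] at h
  rwa [hm.mul_left_eq_zero] at h

/-- Modulo X^m, multiplication by X^(m-1) sees only the constant coefficient. -/
lemma mk_eq_truncatedTop {m : ℕ} (hm : m ≠ 0) (P : R[X]) :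
    Ideal.Quotient.mk (Ideal.span {(X : R[X]) ^ m}) (P * ((m : R[X]) * X ^ (m - 1))) =
      truncatedTop m (P.coeff 0) := by
  rw [truncatedTop_apply, Ideal.Quotient.mk_eq_mk_iff_sub_mem, ← sub_mul,
    Ideal.mem_span_singleton]
  obtain ⟨Q, hQ⟩ := X_dvd_iff.2 (show (P - C (P.coeff 0)).coeff 0 = 0 by simp)
  rw [hQ]
  refine ⟨Q * m, ?_⟩
  obtain ⟨l, rfl⟩ := Nat.exists_eq_succ_of_ne_zero hm
  simp only [Nat.succ_eq_add_one, Nat.add_sub_cancel]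
  ring

lemma truncatedTop_mul {m : ℕ} (hm : m ≠ 0) (p : Truncated R (m + 1)) (hn : 2 ≤ m + 1) (r : R) :
    truncatedTop m ((truncatedToDual hn p).fst * r) = truncate m p * truncatedTop m r := by
  obtain ⟨P, rfl⟩ := Ideal.Quotient.mk_surjective p
  rw [truncatedToDual_mk, truncate_mk, truncatedTop_apply m r, ← map_mul, ← mul_assoc,
    mk_eq_truncatedTop hm]
  simp

/-- Write the polynomial as XQ. The derivative of X^m Q^m is m X^(m-1) Q^m plus a multiple of X^m,
and modulo X^m the first term depends only on Q(0), the coefficient of X in XQ. -/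
lemma truncatedDerivative_pow {m : ℕ} (hm : m ≠ 0) (p : Truncated R (m + 1)) (hn : 2 ≤ m + 1)
    (hp : (truncatedToDual hn p).fst = 0) :
    truncatedDerivative m (p ^ m) = truncatedTop m ((truncatedToDual hn p).snd ^ m) := by
  obtain ⟨P, rfl⟩ := Ideal.Quotient.mk_surjective p
  rw [truncatedToDual_mk] at hp ⊢
  obtain ⟨Q, rfl⟩ := X_dvd_iff.2 (show P.coeff 0 = 0 by simpa using hp)
  have h1 : (TrivSqZeroExt.inl ((X * Q).coeff 0) + TrivSqZeroExt.inr ((X * Q).coeff 1) :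
      DualNumber R).snd ^ m = (Q ^ m).coeff 0 := by
    simp [coeff_zero_eq_eval_zero, coeff_X_mul (n := 0)]
  rw [h1, ← mk_eq_truncatedTop hm, ← map_pow, truncatedDerivative_mk, mul_pow, derivative_mul,
    Ideal.Quotient.mk_eq_mk_iff_sub_mem, Ideal.mem_span_singleton, derivative_X_pow]
  refine ⟨derivative (Q ^ m), ?_⟩
  simp only [C_eq_natCast]
  ring

lemma truncate_eq_zero {m : ℕ} {p : Truncated R (m + 1)}
    (hp : p ∈ Ideal.span {Ideal.Quotient.mk (Ideal.span {(X : R[X]) ^ (m + 1)}) X} ^ m) :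
    truncate m p = 0 := by
  rw [Ideal.span_singleton_pow, Ideal.mem_span_singleton] at hp
  obtain ⟨q, rfl⟩ := hp
  rw [map_mul, map_pow, truncate_mk, ← map_pow, Ideal.Quotient.eq_zero_iff_mem.2
    (Ideal.mem_span_singleton_self _), zero_mul]

lemma mem_span_of_fst_eq_zero {n : ℕ} (hn : 2 ≤ n) {p : Truncated R n}
    (hp : (truncatedToDual hn p).fst = 0) :
    p ∈ Ideal.span {Ideal.Quotient.mk (Ideal.span {(X : R[X]) ^ n}) X} := by
  obtain ⟨P, rfl⟩ := Ideal.Quotient.mk_surjective p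
  rw [truncatedToDual_mk] at hp
  obtain ⟨Q, rfl⟩ := X_dvd_iff.2 (show P.coeff 0 = 0 by simpa using hp)
  rw [map_mul, Ideal.mem_span_singleton]
  exact dvd_mul_right _ _

lemma pow_eq_zero_of_fst_eq_zero {n : ℕ} (hn : 2 ≤ n) {p : Truncated R n}
    (hp : (truncatedToDual hn p).fst = 0) : p ^ n = 0 := by
  have h := Ideal.pow_mem_pow (mem_span_of_fst_eq_zero hn hp) n
  rwa [Ideal.span_singleton_pow, ← map_pow, Ideal.Quotient.eq_zero_iff_mem.2
    (Ideal.mem_span_singleton_self _), Ideal.span_singleton_zero, Ideal.mem_bot] at h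

/-- Transversal derivations from a homomorphism to truncated polynomials. -/
def transversalDataOfHom {K A R : Type u} [CommRing K] [CommRing A] [CommRing R] (π : A →+* R)
    (κ : K →+* A) {m : ℕ} (hm : m ≠ 0) (hn : 2 ≤ m + 1) (hu : IsUnit (m : R))
    (φ : A →+* Truncated R (m + 1)) (hφ : ∀ a, (truncatedToDual hn (φ a)).fst = π a)
    (hκ : ∀ r, truncatedDerivative m (φ (κ r)) = 0) (z : A)
    (hz : RingHom.ker π = Ideal.span {z}) (hz' : z ^ (m + 1) = 0)
    (hzu : IsUnit (truncatedToDual hn (φ z)).snd) : TransversalData π κ m :=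
  letI : Module A (Truncated R m) := Module.compHom _ ((truncate m).comp φ)
  { z := z
    ker_eq := hz
    pow_eq_zero := hz'
    c := AddMonoidHom.mk' (fun a => (truncatedToDual hn (φ a)).snd) (fun a b => by simp)
    c_mul := fun a b => by simp [hφ, mul_comm]
    isUnit_c := hzu
    N := Truncated R m
    δ := (truncatedDerivative m).comp φ.toAddMonoidHom
    δ_mul := fun a b => by
      change truncatedDerivative m (φ (a * b)) = _
      rw [map_mul, truncatedDerivative_mul]
      rfl
    δ_const := hκ
    τ := truncatedTop m
    τ_smul := fun a r => by
      rw [← hφ, truncatedTop_mul hm]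
      rfl
    τ_injective := truncatedTop_injective hu hm
    smul_eq_zero := fun a ha n => by
      have h1 : φ a ∈ Ideal.span {Ideal.Quotient.mk (Ideal.span {(X : R[X]) ^ (m + 1)}) X} ^ m := by
        have h2 := Ideal.mem_map_of_mem φ ha
        rw [Ideal.map_pow] at h2
        refine Ideal.pow_right_mono (Ideal.map_le_iff_le_comap.2 fun b hb => ?_) m h2
        exact mem_span_of_fst_eq_zero hn ((hφ b).trans hb)
      change truncate m (φ a) * n = 0
      rw [truncate_eq_zero h1, zero_mul]
    δ_pow := fun a ha => by
      change truncatedDerivative m (φ (a ^ m)) = _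
      rw [map_pow, truncatedDerivative_pow hm _ hn ((hφ a).trans ha)]
      rfl }

/-- A derivation of a smooth algebra integrates to a homomorphism to truncated polynomials. -/
lemma exists_lift_truncated {k B R : Type*} [CommRing k] [CommRing B] [CommRing R] [Algebra k B]
    [Algebra k R] [Algebra B R] [IsScalarTower k B R] [Algebra.FormallySmooth k B] {n : ℕ}
    (hn : 2 ≤ n) (D : Derivation k B R) : ∃ φ : B →ₐ[k] Truncated R n,
      (∀ b, (truncatedToDual hn (φ b)).fst = algebraMap B R b) ∧
      ∀ b, (truncatedToDual hn (φ b)).snd = D b := by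
  have h := Algebra.FormallySmooth.liftOfSurjective_apply (dualNumberHom D)
    ((truncatedToDual hn).restrictScalars k) (truncatedToDual_surjective hn)
    (isNilpotent_ker_truncatedToDual hn)
  refine ⟨Algebra.FormallySmooth.liftOfSurjective (dualNumberHom D)
    ((truncatedToDual hn).restrictScalars k) (truncatedToDual_surjective hn)
    (isNilpotent_ker_truncatedToDual hn), fun b => ?_, fun b => ?_⟩
  · refine (congrArg TrivSqZeroExt.fst (h b)).trans ?_
    simp [dualNumberHom]
  · refine (congrArg TrivSqZeroExt.snd (h b)).trans ?_
    simp [dualNumberHom]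

/-- Transversal derivations of a thickening of a smooth curve in a smooth surface. -/
theorem nonempty_transversalData {k B A R : Type u} [Field k] [CharZero k] [CommRing B]
    [CommRing A] [CommRing R] [IsLocalRing R] [Algebra k B] [Algebra k R]
    [Algebra.FormallySmooth k B] (e : Module.Basis (Fin 2) B Ω[B⁄k]) {w : Ω[R⁄k]}
    (hw : Submodule.span R {w} = ⊤) (q : B →+* A) (hq : Function.Surjective q) (π : A →+* R)
    (hπ : Function.Surjective π) (κ : k →+* A) (hκ : ∀ r, q (algebraMap k B r) = κ r)
    (hκ' : ∀ r, π (κ r) = algebraMap k R r) {m : ℕ} (hm : m ≠ 0) {z : B}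
    (hqz : RingHom.ker q = Ideal.span {z ^ (m + 1)})
    (hz : RingHom.ker (π.comp q) = Ideal.span {z}) : Nonempty (TransversalData π κ m) := by
  let : Algebra B R := (π.comp q).toAlgebra
  have hBR (b : B) : algebraMap B R b = π (q b) := rfl
  have : IsScalarTower k B R := IsScalarTower.of_algebraMap_eq fun r => by
    rw [hBR, hκ, hκ']
  have hn : 2 ≤ m + 1 := by omega
  obtain ⟨D, hD⟩ := exists_derivation_isUnit k (B := B) (R := R) (hπ.comp hq) hz e hw
  obtain ⟨φ, hφ₁, hφ₂⟩ := exists_lift_truncated hn D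
  have hz0 : π (q z) = 0 := by
    have h : z ∈ RingHom.ker (π.comp q) := by
      rw [hz]; exact Ideal.mem_span_singleton_self z
    exact h
  -- The constant term of `φ z` is the image of `z` in `R`, which is zero. So `φ z` is a multiple of
  -- X, its power of exponent m + 1 vanishes, and `φ` descends to `A`.
  have hker : ∀ b, q b = 0 → φ b = 0 := by
    intro b hb
    have h : b ∈ RingHom.ker q := hb
    rw [hqz, Ideal.mem_span_singleton] at h
    obtain ⟨b, rfl⟩ := h
    rw [map_mul, map_pow, pow_eq_zero_of_fst_eq_zero hn ((hφ₁ z).trans hz0), zero_mul]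
  let φ' : A →+* Truncated R (m + 1) := q.liftOfSurjective hq ⟨φ.toRingHom, fun b hb => hker b hb⟩
  have hφ' (b : B) : φ' (q b) = φ b :=
    q.liftOfRightInverse_comp_apply _ (Function.rightInverse_surjInv hq) ⟨φ.toRingHom, _⟩ b
  refine ⟨transversalDataOfHom π κ hm hn ?_ φ' ?_ ?_ (q z) ?_ ?_ ?_⟩
  · have h : IsUnit ((m : k)) := (Nat.cast_ne_zero.2 hm).isUnit
    simpa using h.map (algebraMap k R)
  · intro a
    obtain ⟨b, rfl⟩ := hq a
    rw [hφ', hφ₁, hBR]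
  · intro r
    rw [← hκ, hφ', AlgHom.commutes, IsScalarTower.algebraMap_apply k R[X] (Truncated R (m + 1)),
      IsScalarTower.algebraMap_apply k R R[X]]
    refine (truncatedDerivative_mk m _).trans ?_
    rw [← C_eq_algebraMap, derivative_C, map_zero]
  · ext a
    obtain ⟨b, rfl⟩ := hq a
    constructor
    · intro h
      have h1 : b ∈ RingHom.ker (π.comp q) := h
      rw [hz, Ideal.mem_span_singleton] at h1
      exact Ideal.mem_span_singleton.2 (map_dvd q h1)
    · intro h
      obtain ⟨a, ha⟩ := Ideal.mem_span_singleton.1 h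
      rw [RingHom.mem_ker, ha, map_mul, hz0, zero_mul]
  · rw [← map_pow]
    change z ^ (m + 1) ∈ RingHom.ker q
    rw [hqz]
    exact Ideal.mem_span_singleton_self _
  · rw [hφ', hφ₂]
    exact hD

end

section

/-! ### Stalks of smooth schemes over a field -/

lemma formallySmooth_and_nonempty_basis (k S T : Type*) [CommRing k] [CommRing S] [CommRing T]
    [Algebra k S] [Algebra S T] [Algebra k T] [IsScalarTower k S T] [Nontrivial S] {n : ℕ}
    [Algebra.IsStandardSmoothOfRelativeDimension n k S] (M : Submonoid S) [IsLocalization M T] :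
    Algebra.FormallySmooth k T ∧ Nonempty (Module.Basis (Fin n) T Ω[T⁄k]) := by
  have : Algebra.IsStandardSmooth k S :=
    Algebra.IsStandardSmoothOfRelativeDimension.isStandardSmooth n
  have : Algebra.FormallySmooth S T := Algebra.FormallySmooth.of_isLocalization M
  refine ⟨Algebra.FormallySmooth.comp k S T, ?_⟩
  have h : Module.finrank S Ω[S⁄k] = n := by
    rw [Module.finrank, Algebra.IsStandardSmoothOfRelativeDimension.rank_kaehlerDifferential n]
    simp
  have : Module.Finite S Ω[S⁄k] := inferInstance
  exact ⟨((Module.finBasisOfFinrankEq S Ω[S⁄k] h).ofIsLocalizedModule T M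
    (KaehlerDifferential.map k k S T))⟩

lemma formallySmooth_stalk {k : Type u} [Field k] {X : Scheme.{u}} (a : X ⟶ Spec (.of k)) (n : ℕ)
    [SmoothOfRelativeDimension n a] (x : X) :
    letI : Algebra k (X.presheaf.stalk x) := (stalkConst a x).toAlgebra
    Algebra.FormallySmooth k (X.presheaf.stalk x) ∧
      Nonempty (Module.Basis (Fin n) (X.presheaf.stalk x) Ω[X.presheaf.stalk x⁄k]) := by
  obtain ⟨U, hU, V, hV, hxV, e, h⟩ :=
    SmoothOfRelativeDimension.exists_isStandardSmoothOfRelativeDimension (n := n) (f := a) x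
  -- The spectrum of a field has a single point.
  have hU' : U = ⊤ := by
    ext y
    have hy : y = a x := @Subsingleton.elim (PrimeSpectrum k) _ _ _
    rw [hy]
    exact ⟨fun _ => trivial, fun _ => e hxV⟩
  subst hU'
  have h' := h.comp (RingHom.IsStandardSmoothOfRelativeDimension.equiv
    (Scheme.ΓSpecIso (.of k)).symm.commRingCatIsoToRingEquiv)
  let φ : k →+* Γ(X, V) := (a.appLE ⊤ V e).hom.comp
    (Scheme.ΓSpecIso (.of k)).symm.commRingCatIsoToRingEquiv.toRingHom
  let : Algebra k Γ(X, V) := φ.toAlgebra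
  let : Algebra Γ(X, V) (X.presheaf.stalk x) := (X.presheaf.germ V x hxV).hom.toAlgebra
  let : Algebra k (X.presheaf.stalk x) := (stalkConst a x).toAlgebra
  have : IsScalarTower k Γ(X, V) (X.presheaf.stalk x) :=
    IsScalarTower.of_algebraMap_eq fun r => (germ_constToPresheaf a V x hxV r).symm
  have : IsLocalization.AtPrime (X.presheaf.stalk x) (hV.primeIdealOf ⟨x, hxV⟩).asIdeal :=
    hV.isLocalization_stalk ⟨x, hxV⟩
  have : Algebra.IsStandardSmoothOfRelativeDimension n k Γ(X, V) := h'
  have : Nontrivial Γ(X, V) := (X.presheaf.germ V x hxV).hom.domain_nontrivial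
  exact formallySmooth_and_nonempty_basis k Γ(X, V) (X.presheaf.stalk x)
    (hV.primeIdealOf ⟨x, hxV⟩).asIdeal.primeCompl

/-! ### The reduced subscheme -/

/-- A nilpotent germ is represented by a nilpotent section on a small affine open set. This matches
the nilradical of the stalk, in which the local embedding is phrased, with the kernel used in
`TransversalData`. -/
lemma ker_stalkMap_nilradical {X : Scheme.{u}} (p : X.nilradical.subscheme) :
    RingHom.ker (X.nilradical.subschemeι.stalkMap p).hom =
      nilradical (X.presheaf.stalk (X.nilradical.subschemeι p)) := by
  ext z
  constructor
  · intro hz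
    obtain ⟨U, hU, f, hf, rfl⟩ := exists_mem_ideal X.nilradical rfl p hz
    have hf' : f ∈ nilradical Γ(X, U.1) := hf
    exact (mem_nilradical.1 hf').map (X.presheaf.germ U.1 _ hU).hom
  · rintro ⟨k, hk⟩
    obtain ⟨U, hU, f, rfl⟩ := TopCat.Presheaf.exists_germ_eq X.presheaf z
    have hk' : X.presheaf.germ U _ hU (f ^ k) = X.presheaf.germ U _ hU 0 := by
      rw [map_pow, map_zero]; exact hk
    obtain ⟨W, hW, j₁, j₂, e⟩ := TopCat.Presheaf.germ_eq X.presheaf _ _ _ _ _ hk'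
    rw [map_zero, map_pow] at e
    obtain ⟨V, hV, hpV, hVW'⟩ := exists_isAffineOpen_mem_and_subset hW
    have hVW : V ≤ W := hVW'
    have h1 : X.presheaf.map (homOfLE hVW ≫ j₁).op f ∈ X.nilradical.ideal ⟨V, hV⟩ := by
      refine ⟨k, ?_⟩
      change X.presheaf.map (homOfLE hVW ≫ j₁).op f ^ k = 0
      rw [← res_res, ← map_pow, e, map_zero]
    rw [← X.nilradical.ker_subschemeι_app] at h1
    have h2 : X.nilradical.subschemeι.app V (X.presheaf.map (homOfLE hVW ≫ j₁).op f) = 0 := h1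
    have hpV' : p ∈ X.nilradical.subschemeι ⁻¹ᵁ V := hpV
    have h3 := germ_app_eq_of_eq rfl V p hpV' hpV (X.presheaf.map (homOfLE hVW ≫ j₁).op f)
    rw [h2, map_zero, germ_res] at h3
    exact h3.symm

lemma subschemeι_nilradical_surjective (X : Scheme.{u}) :
    Function.Surjective X.nilradical.subschemeι := by
  rw [← Set.range_eq_univ, Scheme.IdealSheafData.range_subschemeι]
  rfl

/-! ### Primitive multiple curves -/

/-- The stalks of a primitive multiple curve have transversal derivations. -/
lemma IsPrimitiveMultipleCurve.nonempty_transversalData {Y : Scheme.{0}} {a : Y ⟶ Spec (.of ℂ)}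
    {m : ℕ} (hm : m ≠ 0) (hY : IsPrimitiveMultipleCurve a (m + 1)) (p : reducedCurve Y)
    (hp : IsClosed {Y.nilradical.subschemeι p}) : Nonempty
      (TransversalData (Y.nilradical.subschemeι.stalkMap p).hom
        (stalkConst a (Y.nilradical.subschemeι p)) m) := by
  obtain ⟨U, hy, S, b, j, hb, hj, hjb, z, hz, hzn⟩ := hY.locallyEmbedded _ hp
  have := hY.smooth
  let y : U := ⟨Y.nilradical.subschemeι p, hy⟩
  let s : S := j y
  let : Algebra ℂ (S.presheaf.stalk s) := (stalkConst b s).toAlgebra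
  let : Algebra ℂ ((reducedCurve Y).presheaf.stalk p) :=
    (stalkConst (Y.nilradical.subschemeι ≫ a) p).toAlgebra
  obtain ⟨hsm, ⟨e⟩⟩ := formallySmooth_stalk b 2 s
  obtain ⟨-, ⟨e'⟩⟩ := formallySmooth_stalk (Y.nilradical.subschemeι ≫ a) 1 p
  let ε : U.toScheme.presheaf.stalk y ≃+* Y.presheaf.stalk (Y.nilradical.subschemeι p) :=
    (U.stalkIso y).commRingCatIsoToRingEquiv
  let q : S.presheaf.stalk s →+* Y.presheaf.stalk (Y.nilradical.subschemeι p) :=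
    ε.toRingHom.comp (j.stalkMap y).hom
  have hε (c : Y.presheaf.stalk (Y.nilradical.subschemeι p)) : ε.symm c = U.ι.stalkMap y c :=
    ConcreteCategory.congr_hom (Scheme.Opens.stalkIso_inv U y) c
  have hq : Function.Surjective q := ε.surjective.comp (j.stalkMap_surjective y)
  -- Smoothness of C in relative dimension 1 gives its differentials a basis with one element.
  obtain ⟨w, hw⟩ : ∃ w, Submodule.span ((reducedCurve Y).presheaf.stalk p) {w} = ⊤ :=
    ⟨e' 0, by rw [← e'.span_eq, Set.range_unique]; rfl⟩
  refine MultipleCurve.nonempty_transversalData e hw q hq _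
    (Y.nilradical.subschemeι.stalkMap_surjective p) _ (fun r => ?_)
    (fun r => stalkMap_stalkConst Y.nilradical.subschemeι a p r) hm (z := z) ?_ ?_
  · apply ε.symm.injective
    refine (ε.symm_apply_apply _).trans ?_
    rw [hε]
    refine (stalkMap_stalkConst j b y r).trans ?_
    rw [hjb]
    exact (stalkMap_stalkConst U.ι a y r).symm
  · rw [← hzn]
    ext c
    exact map_eq_zero_iff ε ε.injective
  · rw [← hz]
    ext c
    have h1 : c ∈ RingHom.ker ((Y.nilradical.subschemeι.stalkMap p).hom.comp q) ↔
        ε (j.stalkMap y c) ∈ RingHom.ker (Y.nilradical.subschemeι.stalkMap p).hom := Iff.rfl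
    rw [h1, ker_stalkMap_nilradical, Ideal.mem_comap, mem_nilradical, mem_nilradical]
    exact IsNilpotent.map_iff ε.injective

lemma shortExact_of_transversalData {R : CommRingCat.{u}} {X : Scheme.{u}} (I : X.IdealSheafData)
    (a : X ⟶ Spec R) {m : ℕ} (hm : m ≠ 0) [JacobsonSpace (I ^ m).subscheme]
    (hI : Function.Surjective I.subschemeι)
    (D : ∀ p : I.subscheme, IsClosed {I.subschemeι p} → Nonempty
      (TransversalData (I.subschemeι.stalkMap p).hom (stalkConst a (I.subschemeι p)) m)) :
    ∃ (ι : (Scheme.Modules.pushforward (powInclusion I hm)).obj (tensorPow (conormal I) m) ⟶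
        (Scheme.Modules.pullback (I ^ m).subschemeι).obj (omega a))
      (w : ι ≫ omegaPullbackMap (I ^ m).subschemeι a = 0),
      (ShortComplex.mk ι (omegaPullbackMap (I ^ m).subschemeι a) w).ShortExact := by
  obtain ⟨hmono, ⟨φ⟩⟩ := mono_conormalToOmega_and_nonempty_iso I a (powInclusion I hm)
    (subschemeι_eq_powInclusion I hm) hI D
  have hepi := epi_omegaPullbackMap (I ^ m).subschemeι a
  have w : (φ.inv ≫ conormalToOmega (I ^ m) a) ≫ omegaPullbackMap (I ^ m).subschemeι a = 0 := by
    rw [Category.assoc, conormalToOmega_comp, comp_zero]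
  refine ⟨_, w, ?_⟩
  have h : (ShortComplex.mk (conormalToOmega (I ^ m) a) (omegaPullbackMap (I ^ m).subschemeι a)
      (conormalToOmega_comp (I ^ m) a)).ShortExact :=
    { exact := conormal_exact (I ^ m) a
      mono_f := hmono
      epi_g := hepi }
  have e : ShortComplex.mk (conormalToOmega (I ^ m) a) (omegaPullbackMap (I ^ m).subschemeι a)
      (conormalToOmega_comp (I ^ m) a) ≅ ShortComplex.mk _ _ w :=
    ShortComplex.isoMk φ (Iso.refl _) (Iso.refl _) (by simp) (by simp)
  exact ShortComplex.shortExact_of_iso e h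

end

end MultipleCurve

end

theorem proposition3p2p1 {Y : Scheme.{0}} (a : Y ⟶ Spec (.of ℂ)) (n : ℕ) (hn : 2 ≤ n)
    (hY : MultipleCurve.IsPrimitiveMultipleCurve a n) :
    Epi (MultipleCurve.rho a (n - 1)) ∧
    Nonempty (kernel (MultipleCurve.rho a (n - 1)) ≅
      MultipleCurve.linePow Y (Nat.sub_ne_zero_of_lt hn) (n - 1)) ∧
    ∃ (ι : MultipleCurve.linePow Y (Nat.sub_ne_zero_of_lt hn) (n - 1) ⟶
          (Scheme.Modules.pullback (MultipleCurve.filtrationι Y (n - 1))).obj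
            (MultipleCurve.omega a))
      (w : ι ≫ MultipleCurve.rho a (n - 1) = 0),
      (ShortComplex.mk ι (MultipleCurve.rho a (n - 1)) w).ShortExact := by
  have hm : n - 1 ≠ 0 := Nat.sub_ne_zero_of_lt hn
  have := hY.locallyOfFiniteType
  -- C_{n-1} is locally of finite type over a field, hence Jacobson; this is why the hypothesis on
  -- local embeddings at closed points is enough.
  have hJ : JacobsonSpace (Y.nilradical ^ (n - 1)).subscheme :=
    LocallyOfFiniteType.jacobsonSpace (MultipleCurve.filtrationι Y (n - 1) ≫ a)
  obtain ⟨ι, w, h⟩ := MultipleCurve.shortExact_of_transversalData Y.nilradical a hm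
    (MultipleCurve.subschemeι_nilradical_surjective Y)
    (MultipleCurve.IsPrimitiveMultipleCurve.nonempty_transversalData hm
      (by rwa [Nat.sub_add_cancel (by omega)]))
  refine ⟨h.epi_g, ⟨?_⟩, ι, w, h⟩
  have := h.mono_f
  exact (kernelIsKernel _).conePointUniqueUpToIso h.fIsKernel
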